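/- Let $n$ be a natural number and let $\mathcal C\subset\mathbb R^n$ be a nonempty, open, convex and bounded set, with its Hilbert geometry. For $p\in\mathcal C$ and $v\neq 0$, the line through $p$ directed by $v$ meets $\partial\mathcal C$ in two points $p^+$ and $p^-$; put $$F_{\mathcal C}(p,v)=\tfrac12\|v\|\left(\frac1{\|p-p^-\|}+\frac1{\|p-p^+\|}\right),\qquad F_{\mathcal C}(p,0)=0 .$$ If $P$ is an affine plane meeting $\mathcal C$, the Hilbert measure of the planar convex domain $\mathcal C\cap P$ is the measure on $\mathcal C\cap P$ with density $p\mapsto \pi/\mathrm{vol}\{v\in\vec P : F_{\mathcal C\cap P}(p,v)<1\}$ with respect to the Euclidean area of $P$, where $\vec P$ is the direction of $P$ and $\mathrm{vol}$ its Euclidean area. An ideal triangle of $\mathcal C$ is a triangle $abc$ with non-collinear vertices $a,b,c\in\partial\mathcal C$ whose interior (in the plane of $a,b,c$) and open sides $]a,b[$, $]b,c[$, $]c,a[$ are contained in $\mathcal C$. Its Hilbert area, an element of $[0,+\infty]$, is the measure of its interior for the Hilbert measure of $\mathcal C\cap P$, where $P$ is the affine plane containing $a,b,c$. An ellipsoid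 is the image of the open Euclidean unit ball of $\mathbb R^n$ under an invertible affine transformation of $\mathbb R^n$. Then: (i) All ideal triangles of $\mathcal C$ have the same Hilbert area if and only if $\mathcal C$ is an ellipsoid; and if $\mathcal C$ is an ellipsoid, every ideal triangle of $\mathcal C$ has Hilbert area $\pi$. (ii) If $\mathcal C$ is not an ellipsoid, there exists an ideal triangle of $\mathcal C$ of Hilbert area strictly greater than $\pi$, and there exists an ideal triangle of $\mathcal C$ of Hilbert area strictly less than $\pi$. -/

import Mathlib

open MeasureTheory

noncomputable section

namespace HilbertGeometry

/-- A convex domain of `ℝⁿ`: a nonempty, open, convex and bounded subset. -/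
structure IsConvexDomain {n : ℕ} (C : Set (EuclideanSpace ℝ (Fin n))) : Prop where
  nonempty : C.Nonempty
  isOpen : IsOpen C
  convex : Convex ℝ C
  isBounded : Bornology.IsBounded C

/-- An (open, solid) ellipsoid of `ℝⁿ`: the image of the open Euclidean unit ball under an
invertible affine transformation. -/
def IsEllipsoid {n : ℕ} (C : Set (EuclideanSpace ℝ (Fin n))) : Prop :=
  ∃ A : EuclideanSpace ℝ (Fin n) ≃ᵃ[ℝ] EuclideanSpace ℝ (Fin n),
    C = A '' Metric.ball 0 1

/-- The point `p⁺` at which the half-line issued from `p ∈ D` with direction `v ≠ 0` leaves the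
bounded convex set `D`. The opposite point `p⁻` is `exitPoint D p (-v)`. -/
def exitPoint {n : ℕ} (D : Set (EuclideanSpace ℝ (Fin n))) (p v : EuclideanSpace ℝ (Fin n)) :
    EuclideanSpace ℝ (Fin n) :=
  p + sSup {t : ℝ | p + t • v ∈ D} • v

/-- The Finsler metric `F_D(p, v) = ½ ‖v‖ (1 / ‖p - p⁻‖ + 1 / ‖p - p⁺‖)` of the Hilbert geometry
of `D`; one has `F_D(p, 0) = 0`. -/
def finsler {n : ℕ} (D : Set (EuclideanSpace ℝ (Fin n))) (p v : EuclideanSpace ℝ (Fin n)) : ℝ :=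
  1 / 2 * ‖v‖ * (1 / ‖p - exitPoint D p (-v)‖ + 1 / ‖p - exitPoint D p v‖)

/-- The open unit ball, in the direction of the affine subspace `P`, of the norm `F_{C ∩ P}(p, ·)`
of the Hilbert geometry of the convex domain `C ∩ P` of `P`. -/
def finslerBall {n : ℕ} (C : Set (EuclideanSpace ℝ (Fin n)))
    (P : AffineSubspace ℝ (EuclideanSpace ℝ (Fin n))) (p : EuclideanSpace ℝ (Fin n)) :
    Set (EuclideanSpace ℝ (Fin n)) :=
  {v | v ∈ P.direction ∧ finsler (C ∩ P) p v < 1}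

/-- The density `ω_k / vol (B_{C ∩ P}(p))` of the Hilbert measure of `C ∩ P`, where `k = dim P`,
`ω_k` is the volume of the unit ball of `ℝᵏ`, and `vol` is the `k`-dimensional Euclidean volume
(the Hausdorff measure normalised so as to agree with Lebesgue measure). -/
def density {n : ℕ} (C : Set (EuclideanSpace ℝ (Fin n)))
    (P : AffineSubspace ℝ (EuclideanSpace ℝ (Fin n))) (p : EuclideanSpace ℝ (Fin n)) : ENNReal :=
  volume (Metric.ball (0 : EuclideanSpace ℝ (Fin (Module.finrank ℝ P.direction))) 1) /
    Measure.euclideanHausdorffMeasure (Module.finrank ℝ P.direction) (finslerBall C P p)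

/-- The Hilbert measure of the convex domain `C ∩ P` of the affine subspace `P`, as a measure
on `ℝⁿ` carried by `C ∩ P`. For `P = ⊤` it is the Hilbert measure of `C`. -/
def hilbertMeasure {n : ℕ} (C : Set (EuclideanSpace ℝ (Fin n)))
    (P : AffineSubspace ℝ (EuclideanSpace ℝ (Fin n))) : Measure (EuclideanSpace ℝ (Fin n)) :=
  ((Measure.euclideanHausdorffMeasure (Module.finrank ℝ P.direction)).restrict
    (C ∩ P)).withDensity (density C P)

/-- The open triangle `abc`. -/
def openTriangle {n : ℕ} (a b c : EuclideanSpace ℝ (Fin n)) : Set (EuclideanSpace ℝ (Fin n)) :=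
  {x | ∃ r s t : ℝ, 0 < r ∧ 0 < s ∧ 0 < t ∧ r + s + t = 1 ∧ x = r • a + s • b + t • c}

/-- `abc` is an ideal triangle of the Hilbert geometry of `C`: the vertices are not collinear and
lie on `∂C`, and the triangle, with its open sides, is contained in `C`. -/
structure IsIdealTriangle {n : ℕ} (C : Set (EuclideanSpace ℝ (Fin n)))
    (a b c : EuclideanSpace ℝ (Fin n)) : Prop where
  affineIndependent : AffineIndependent ℝ ![a, b, c]
  left_mem : a ∈ frontier C
  middle_mem : b ∈ frontier C
  right_mem : c ∈ frontier C
  triangle_subset : openTriangle a b c ⊆ C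
  side_ab_subset : openSegment ℝ a b ⊆ C
  side_bc_subset : openSegment ℝ b c ⊆ C
  side_ca_subset : openSegment ℝ c a ⊆ C

/-- The Hilbert area of the triangle `abc`: its measure for the Hilbert measure of `C ∩ P`, where
`P` is the affine plane spanned by `a`, `b` and `c`. -/
def triangleArea {n : ℕ} (C : Set (EuclideanSpace ℝ (Fin n))) (a b c : EuclideanSpace ℝ (Fin n)) :
    ENNReal :=
  hilbertMeasure C (affineSpan ℝ {a, b, c}) (openTriangle a b c)

end HilbertGeometry

end

/-! The Hilbert area of a plane domain is invariant under affine bijections, and enlarging the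
domain makes the Hilbert unit balls larger, hence the area of a fixed triangle strictly smaller when
it is finite (`hilbertArea_preimage`, `hilbertArea_lt_of_ssubset`). For the unit ball the metric is
Klein's model of the hyperbolic plane, and an explicit integration gives π for every ideal triangle
(`hilbertArea_chart_ball`).

A plane domain D that is not an ellipse is compared with its extremal ellipses. The inscribed
ellipse of largest area touches ∂D in at least three points, for otherwise a small affine
perturbation would enlarge it. Three contact points form an ideal triangle of both domains; its area
is π in the ellipse, so it is less than π in D. Dually, three contact points with the smallest
circumscribed ellipse give a triangle of area greater than π, provided its open sides lie in D. If
one side lies in ∂D, then D has a corner at the end of that side, between the side and the tangent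
to the ellipse. The Hilbert density there is at least homogeneous of degree -2, which is not
integrable, and ideal triangles with a vertex sliding along the side towards the corner have
arbitrarily large areas (`exists_large_ideal_triangle`).

In dimension n it remains to find a plane section that is not an ellipse. Fix p in C. If all plane
sections through p are ellipses, then the squared Hilbert norm at p is a quadratic form and the odd
part of the exit rate is linear, since both properties involve only two vectors at a time. This
writes C as the solution set of a quadratic inequality with positive definite leading part, that is,
an ellipsoid (`isEllipsoid_of_sections`). -/

set_option linter.unusedSectionVars false

noncomputable section

namespace HilbertGeometry

open Module Set Filter Topology

/-! ### Exit rates and the Hilbert norm. -/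

section Rate

variable {E F : Type*} [NormedAddCommGroup E] [NormedSpace ℝ E]
  [NormedAddCommGroup F] [NormedSpace ℝ F]

/-- The inverse of the time at which the half-line issued from `x` with velocity `v` leaves `D`. -/
def exitRate (D : Set E) (x v : E) : ℝ := gauge ((fun w => x + w) ⁻¹' D) v

/-- The Hilbert norm of `v` at `x`, in terms of exit rates. -/
def hilbertNorm (D : Set E) (x v : E) : ℝ := (exitRate D x v + exitRate D x (-v)) / 2

theorem exitRate_eq_sInf (D : Set E) (x v : E) :
    exitRate D x v = sInf {r | 0 < r ∧ x + r⁻¹ • v ∈ D} := by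
  rw [exitRate, gauge_def']; rfl

theorem exitRate_preimage (ψ : E →ᵃ[ℝ] F) (D : Set F) (x v : E) :
    exitRate (ψ ⁻¹' D) x v = exitRate D (ψ x) (ψ.linear v) := by
  simp only [exitRate_eq_sInf, mem_preimage]
  congr! 4 with r
  rw [add_comm x, ← vadd_eq_add, AffineMap.map_vadd, vadd_eq_add, add_comm, map_smul]

theorem hilbertNorm_preimage (ψ : E →ᵃ[ℝ] F) (D : Set F) (x v : E) :
    hilbertNorm (ψ ⁻¹' D) x v = hilbertNorm D (ψ x) (ψ.linear v) := by
  simp [hilbertNorm, exitRate_preimage]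

theorem exitRate_nonneg (D : Set E) (x v : E) : 0 ≤ exitRate D x v := gauge_nonneg _

theorem exitRate_smul (D : Set E) (x v : E) {r : ℝ} (hr : 0 ≤ r) :
    exitRate D x (r • v) = r * exitRate D x v := by
  simp [exitRate, gauge_smul_of_nonneg hr]

theorem hilbertNorm_nonneg (D : Set E) (x v : E) : 0 ≤ hilbertNorm D x v := by
  have := exitRate_nonneg D x v
  have := exitRate_nonneg D x (-v)
  unfold hilbertNorm
  positivity

theorem hilbertNorm_neg (D : Set E) (x v : E) : hilbertNorm D x (-v) = hilbertNorm D x v := by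
  rw [hilbertNorm, hilbertNorm, neg_neg, add_comm]

theorem hilbertNorm_smul (D : Set E) (x v : E) {r : ℝ} (hr : 0 ≤ r) :
    hilbertNorm D x (r • v) = r * hilbertNorm D x v := by
  rw [hilbertNorm, ← smul_neg, exitRate_smul _ _ _ hr, exitRate_smul _ _ _ hr, hilbertNorm]
  ring

theorem hilbertNorm_zero (D : Set E) (x : E) : hilbertNorm D x 0 = 0 := by
  simp [hilbertNorm, exitRate]

section Open

variable {D D' : Set E} {x : E}

theorem shift_mem_nhds (ho : IsOpen D) (hx : x ∈ D) :
    (fun w => x + w) ⁻¹' D ∈ 𝓝 (0 : E) :=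
  (ho.preimage (by fun_prop)).mem_nhds (by simpa using hx)

theorem convex_shift (hc : Convex ℝ D) : Convex ℝ ((fun w => x + w) ⁻¹' D) :=
  hc.translate_preimage_right x

theorem continuous_exitRate (ho : IsOpen D) (hc : Convex ℝ D) (hx : x ∈ D) :
    Continuous (exitRate D x) :=
  continuous_gauge (convex_shift hc) (shift_mem_nhds ho hx)

theorem continuous_hilbertNorm (ho : IsOpen D) (hc : Convex ℝ D) (hx : x ∈ D) :
    Continuous (hilbertNorm D x) := by
  have h := continuous_exitRate ho hc hx
  unfold hilbertNorm
  fun_prop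

theorem exitRate_lt_one_iff (ho : IsOpen D) (hc : Convex ℝ D) (hx : x ∈ D) (v : E) :
    exitRate D x v < 1 ↔ x + v ∈ D := by
  have h := setOfPred_gauge_lt_one_eq_self_of_isOpen (convex_shift (x := x) hc)
    (mem_of_mem_nhds (shift_mem_nhds ho hx)) (ho.preimage (by fun_prop))
  exact Set.ext_iff.1 h v

theorem exitRate_lt_iff (ho : IsOpen D) (hc : Convex ℝ D) (hx : x ∈ D) (v : E) {r : ℝ}
    (hr : 0 < r) : exitRate D x v < r ↔ x + r⁻¹ • v ∈ D := by
  rw [← exitRate_lt_one_iff ho hc hx, exitRate_smul _ _ _ (inv_nonneg.2 hr.le),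
    inv_mul_lt_iff₀ hr, mul_one]

theorem exitRate_pos (ho : IsOpen D) (hb : Bornology.IsBounded D) (hx : x ∈ D) {v : E}
    (hv : v ≠ 0) : 0 < exitRate D x v := by
  refine (gauge_pos (absorbent_nhds_zero (shift_mem_nhds ho hx)) ?_).2 hv
  refine NormedSpace.isVonNBounded_of_isBounded ℝ ?_
  obtain ⟨R, hR⟩ := hb.subset_closedBall 0
  refine (Metric.isBounded_closedBall (x := (0 : E)) (r := R + ‖x‖)).subset fun w hw => ?_
  have h1 := hR hw
  simp only [Metric.mem_closedBall, dist_zero_right] at h1 ⊢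
  calc ‖w‖ = ‖(x + w) - x‖ := by simp
    _ ≤ ‖x + w‖ + ‖x‖ := norm_sub_le _ _
    _ ≤ _ := by gcongr

theorem exitRate_anti (ho : IsOpen D) (hx : x ∈ D) (h : D ⊆ D') (v : E) :
    exitRate D' x v ≤ exitRate D x v :=
  gauge_mono (absorbent_nhds_zero (shift_mem_nhds ho hx)) (preimage_mono h) v

theorem hilbertNorm_anti (ho : IsOpen D) (hx : x ∈ D) (h : D ⊆ D') (v : E) :
    hilbertNorm D' x v ≤ hilbertNorm D x v := by
  have h1 := exitRate_anti ho hx h v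
  have h2 := exitRate_anti ho hx h (-v)
  unfold hilbertNorm
  linarith

/-- This ties the supremum in `exitPoint` to the gauge. Negative times do not affect the supremum,
because 0 is an admissible time. -/
theorem inv_exitTime (ho : IsOpen D) (hc : Convex ℝ D) (hb : Bornology.IsBounded D) (hx : x ∈ D)
    {v : E} (hv : v ≠ 0) : 0 < sSup {t : ℝ | x + t • v ∈ D} ∧
      1 / sSup {t : ℝ | x + t • v ∈ D} = exitRate D x v := by
  have hg := exitRate_pos ho hb hx hv
  have key : ∀ t : ℝ, 0 < t → (x + t • v ∈ D ↔ t < (exitRate D x v)⁻¹) := fun t ht => by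
    rw [← exitRate_lt_one_iff ho hc hx, exitRate_smul _ _ _ ht.le, ← lt_div_iff₀ hg, one_div]
  have hs : sSup {t : ℝ | x + t • v ∈ D} = (exitRate D x v)⁻¹ := by
    have hpos := inv_pos.2 hg
    refine csSup_eq_of_forall_le_of_forall_lt_exists_gt ⟨0, by simpa using hx⟩ ?_ ?_
    · intro t ht
      rcases le_or_gt t 0 with h0 | h0
      · linarith
      · exact ((key t h0).1 ht).le
    · intro w hw
      obtain ⟨t, ht1, ht2⟩ := exists_between (max_lt hw hpos)
      have h0 : 0 < t := (le_max_right _ _).trans_lt ht1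
      exact ⟨t, (key t h0).2 ht2, (le_max_left _ _).trans_lt ht1⟩
  rw [hs]
  exact ⟨inv_pos.2 hg, by simp⟩

end Open

end Rate

/-! ### Affine invariance of the Hilbert area. -/

section Area

variable {E F : Type*} [NormedAddCommGroup E] [NormedSpace ℝ E]
  [MeasurableSpace E] [NormedAddCommGroup F] [NormedSpace ℝ F]
  [MeasurableSpace F]

/-- The Hilbert area of `S` in the domain `D` of a plane endowed with the Haar measure `μ`. -/
def hilbertArea (μ : Measure E) (D S : Set E) : ENNReal :=
  ∫⁻ x in S, ENNReal.ofReal Real.pi / μ {v | hilbertNorm D x v < 1} ∂μ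

theorem hilbertArea_smul_measure (μ : Measure E) {c : ENNReal} (h0 : c ≠ 0) (h1 : c ≠ ⊤)
    (D S : Set E) : hilbertArea (c • μ) D S = hilbertArea μ D S := by
  unfold hilbertArea
  rw [Measure.restrict_smul, lintegral_smul_measure, smul_eq_mul, ← lintegral_const_mul' _ _ h1]
  refine lintegral_congr fun x => ?_
  rw [Measure.smul_apply, smul_eq_mul, ← mul_div_assoc, ENNReal.mul_div_mul_left _ _ h0 h1]

variable [BorelSpace E] [BorelSpace F] [FiniteDimensional ℝ E] [FiniteDimensional ℝ F]

/-- Uniqueness of Haar measure makes ν a multiple of the image of μ. The factor cancels between the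
reference measure and the measure of the unit ball in the denominator. -/
theorem hilbertArea_preimage (μ : Measure E) [μ.IsAddHaarMeasure] (ν : Measure F)
    [ν.IsAddHaarMeasure] (ψ : E ≃ᵃ[ℝ] F) (D S : Set F) :
    hilbertArea μ (ψ ⁻¹' D) (ψ ⁻¹' S) = hilbertArea ν D S := by
  let L : E ≃L[ℝ] F := ψ.linear.toContinuousLinearEquiv
  have hψ : ⇑ψ = fun x => ψ 0 + L x := by
    funext x
    have := ψ.map_vadd 0 x
    rw [vadd_eq_add, add_zero, vadd_eq_add, add_comm] at this
    exact this
  let m : Measure F := μ.map L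
  have hm : m.IsAddHaarMeasure := L.isAddHaarMeasure_map μ
  have hmap : μ.map ψ = m := by
    have h2 : m.map (fun y => ψ 0 + y) = m := map_add_left_eq_self m (ψ 0)
    rw [hψ, ← h2, Measure.map_map (by fun_prop) L.continuous.measurable]
    rfl
  have hν : ν = (ν.addHaarScalarFactor m : ENNReal) • m := by
    conv_lhs => rw [Measure.isAddLeftInvariant_eq_smul ν m]
    rfl
  have hne : (ν.addHaarScalarFactor m : ENNReal) ≠ 0 := by
    simpa using (Measure.addHaarScalarFactor_pos_of_isAddHaarMeasure ν m).ne'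
  rw [hν, hilbertArea_smul_measure m hne (by simp)]
  have he : MeasurableEmbedding ψ := by
    rw [hψ]
    exact (MeasurableEquiv.addLeft (ψ 0)).measurableEmbedding.comp
      L.toHomeomorph.measurableEmbedding
  unfold hilbertArea
  rw [← hmap, he.restrict_map, he.lintegral_map]
  refine lintegral_congr fun x => ?_
  have hm' (B : Set F) : m B = μ (L ⁻¹' B) := L.toHomeomorph.measurableEmbedding.map_apply μ B
  rw [hmap, hm']
  congr 2
  ext v
  have := hilbertNorm_preimage ψ.toAffineMap D x v
  simp only [mem_ofPred_eq, mem_preimage]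
  exact this ▸ Iff.rfl

end Area

/-! ### Strict monotonicity of the area in the domain. -/

section Strict

variable {E : Type*} [NormedAddCommGroup E] [NormedSpace ℝ E]
  [MeasurableSpace E] [BorelSpace E] [FiniteDimensional ℝ E] {μ : Measure E} {D D' : Set E}
  {x : E}

theorem isBounded_hilbertBall (ho : IsOpen D) (hc : Convex ℝ D) (hb : Bornology.IsBounded D)
    (hx : x ∈ D) : Bornology.IsBounded {v | hilbertNorm D x v < 1} := by
  obtain ⟨R, hR⟩ := hb.subset_closedBall 0
  refine (Metric.isBounded_closedBall (x := (0 : E)) (r := 2 * (R + ‖x‖))).subset fun v hv => ?_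
  have h0 := exitRate_nonneg D x (-v)
  simp only [mem_ofPred_eq, hilbertNorm] at hv
  -- Two nonnegative rates of mean less than 1 are each less than 2, so x + v/2 lies in D.
  have h1 := (exitRate_lt_iff ho hc hx v (r := 2) (by norm_num)).1 (by linarith)
  have h2 := hR h1
  simp only [Metric.mem_closedBall, dist_zero_right] at h2 ⊢
  have h3 : v = (2 : ℝ) • ((x + (2 : ℝ)⁻¹ • v) - x) := by
    rw [add_sub_cancel_left, smul_smul]; norm_num
  have h4 := norm_sub_le (x + (2 : ℝ)⁻¹ • v) x
  rw [h3, norm_smul, Real.norm_ofNat]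
  linarith

theorem measure_hilbertBall_ne_top [μ.IsAddHaarMeasure] (ho : IsOpen D) (hc : Convex ℝ D)
    (hb : Bornology.IsBounded D) (hx : x ∈ D) : μ {v | hilbertNorm D x v < 1} ≠ ⊤ :=
  (isBounded_hilbertBall ho hc hb hx).measure_lt_top.ne

/-- In the direction of a point of D' outside D the two norms differ. Between the two unit balls
there is then a nonempty open set, which has positive measure. -/
theorem measure_hilbertBall_lt [μ.IsAddHaarMeasure] (ho : IsOpen D) (hc : Convex ℝ D)
    (hb : Bornology.IsBounded D)
    (ho' : IsOpen D') (hc' : Convex ℝ D') (h : D ⊂ D') (hx : x ∈ D) :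
    μ {v | hilbertNorm D x v < 1} < μ {v | hilbertNorm D' x v < 1} := by
  have hx' := h.1 hx
  obtain ⟨y, hy', hy⟩ := not_subset.1 h.2
  set v := y - x with hv
  have h1 : exitRate D' x v < 1 := (exitRate_lt_one_iff ho' hc' hx' v).2 (by simpa [hv] using hy')
  have h2 : 1 ≤ exitRate D x v := by
    rw [← not_lt, exitRate_lt_one_iff ho hc hx]; simpa [hv] using hy
  have h3 := exitRate_anti ho hx h.1 (-v)
  have h4 : hilbertNorm D' x v < hilbertNorm D x v := by unfold hilbertNorm; linarith
  obtain ⟨k, hk1, hk2⟩ := exists_between h4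
  have hk : 0 < k := (hilbertNorm_nonneg _ _ _).trans_lt hk1
  have hki := inv_pos.2 hk
  have hcont := continuous_hilbertNorm ho hc hx
  have hcont' := continuous_hilbertNorm ho' hc' hx'
  set U : Set E := {w | hilbertNorm D' x w < 1 ∧ 1 < hilbertNorm D x w} with hU
  have hUo : IsOpen U :=
    (isOpen_lt hcont' continuous_const).inter (isOpen_lt continuous_const hcont)
  have hUn : U.Nonempty := by
    refine ⟨k⁻¹ • v, ?_, ?_⟩ <;> rw [hilbertNorm_smul _ _ _ hki.le]
    · rwa [inv_mul_lt_iff₀ hk, mul_one]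
    · rwa [lt_inv_mul_iff₀ hk, mul_one]
  have hdisj : Disjoint {v | hilbertNorm D x v < 1} U := by
    rw [disjoint_left]
    intro w hw hw'
    exact lt_asymm hw hw'.2
  calc μ {v | hilbertNorm D x v < 1}
      < μ {v | hilbertNorm D x v < 1} + μ U :=
        ENNReal.lt_add_right (measure_hilbertBall_ne_top ho hc hb hx) (hUo.measure_pos μ hUn).ne'
    _ = μ ({v | hilbertNorm D x v < 1} ∪ U) := (measure_union hdisj hUo.measurableSet).symm
    _ ≤ _ := by
      refine measure_mono (union_subset (fun w hw => ?_) fun w hw => hw.1)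
      exact (hilbertNorm_anti ho hx h.1 w).trans_lt hw

/-- The unit balls over D are the fibres of an open subset of E × E, so their measure depends
measurably on the base point. -/
theorem exists_measurable_density [μ.IsAddHaarMeasure] (ho : IsOpen D) (hc : Convex ℝ D) :
    ∃ f : E → ENNReal, Measurable f ∧ ∀ x ∈ D, f x = μ {v | hilbertNorm D x v < 1} := by
  let W : Set (E × E) := ⋃ (r : ℝ) (_ : 0 < r) (s : ℝ) (_ : 0 < s) (_ : r + s ≤ 2),
    {p | p.1 ∈ D ∧ p.1 + r⁻¹ • p.2 ∈ D ∧ p.1 + s⁻¹ • (-p.2) ∈ D}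
  have hW : IsOpen W := by
    refine isOpen_iUnion fun r => isOpen_iUnion fun _ => isOpen_iUnion fun s =>
      isOpen_iUnion fun _ => isOpen_iUnion fun _ => ?_
    refine (ho.preimage (by fun_prop : Continuous fun p : E × E => p.1)).inter
      ((ho.preimage (by fun_prop : Continuous fun p : E × E => p.1 + r⁻¹ • p.2)).inter
      (ho.preimage (by fun_prop : Continuous fun p : E × E => p.1 + s⁻¹ • (-p.2))))
  refine ⟨fun x => μ (Prod.mk x ⁻¹' W), measurable_measure_prodMk_left hW.measurableSet,
    fun x hx => ?_⟩
  refine congrArg μ (Set.ext fun v => ?_)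
  simp only [W, mem_preimage, mem_iUnion, mem_ofPred_eq, exists_prop]
  constructor
  · rintro ⟨r, hr, s, hs, hrs, -, h1, h2⟩
    have h1 := (exitRate_lt_iff ho hc hx v hr).2 h1
    have h2 := (exitRate_lt_iff ho hc hx (-v) hs).2 h2
    unfold hilbertNorm
    linarith
  · intro h
    unfold hilbertNorm at h
    -- The slack is shared equally, so that the two enlarged rates add up to exactly 2.
    set e := (2 - (exitRate D x v + exitRate D x (-v))) / 2 with he
    have h0 := exitRate_nonneg D x v
    have h0' := exitRate_nonneg D x (-v)
    have hr : 0 < exitRate D x v + e := by linarith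
    have hs : 0 < exitRate D x (-v) + e := by linarith
    exact ⟨_, hr, _, hs, by linarith, hx, (exitRate_lt_iff ho hc hx v hr).1 (by linarith),
      (exitRate_lt_iff ho hc hx (-v) hs).1 (by linarith)⟩

theorem hilbertArea_lt_of_ssubset [μ.IsAddHaarMeasure] (ho : IsOpen D) (hc : Convex ℝ D)
    (hb : Bornology.IsBounded D) (ho' : IsOpen D') (hc' : Convex ℝ D') (h : D ⊂ D') {S : Set E}
    (hS : IsOpen S) (hSn : S.Nonempty) (hSD : S ⊆ D) (hfin : hilbertArea μ D' S ≠ ⊤) :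
    hilbertArea μ D' S < hilbertArea μ D S := by
  obtain ⟨f, hf, hfD⟩ := exists_measurable_density (μ := μ) ho hc
  have : hilbertArea μ D S = ∫⁻ x in S, ENNReal.ofReal Real.pi / f x ∂μ :=
    setLIntegral_congr_fun hS.measurableSet fun x hx => by simp only [hfD x (hSD hx)]
  rw [this]
  refine setLIntegral_strict_mono hS.measurableSet (hS.measure_pos μ hSn).ne' (by fun_prop) hfin
    (Eventually.of_forall fun x hx => ?_)
  rw [hfD x (hSD hx)]
  exact ENNReal.div_lt_div_left (by simpa using Real.pi_pos) (by simp)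
    (measure_hilbertBall_lt ho hc hb ho' hc' h (hSD hx))

end Strict

/-! ### Reduction of triangle areas to the Euclidean plane. -/

/-- The Euclidean plane. -/
abbrev Plane := EuclideanSpace ℝ (Fin 2)

variable {n : ℕ}

theorem range_triple {α : Type*} (a b c : α) : range ![a, b, c] = {a, b, c} := by
  simp only [Matrix.range_cons, Matrix.range_empty, union_empty]
  rfl

theorem affineIndependent_map_triple {V W : Type*} [NormedAddCommGroup V] [NormedSpace ℝ V]
    [NormedAddCommGroup W] [NormedSpace ℝ W] (ψ : V →ᵃ[ℝ] W) (hψ : Function.Injective ψ)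
    {a b c : V} :
    AffineIndependent ℝ ![ψ a, ψ b, ψ c] ↔ AffineIndependent ℝ ![a, b, c] := by
  have : ψ ∘ ![a, b, c] = ![ψ a, ψ b, ψ c] := by
    funext i
    fin_cases i <;> rfl
  rw [← this, AffineMap.affineIndependent_iff ψ hψ]

theorem volume_ball_of_eq_two {k : ℕ} (h : k = 2) :
    volume (Metric.ball (0 : EuclideanSpace ℝ (Fin k)) 1) = ENNReal.ofReal Real.pi := by
  subst h
  simp [EuclideanSpace.volume_ball_fin_two, ENNReal.ofReal]

theorem finrank_direction_affineSpan {a b c : EuclideanSpace ℝ (Fin n)}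
    (h : AffineIndependent ℝ ![a, b, c]) :
    finrank ℝ (affineSpan ℝ {a, b, c}).direction = 2 := by
  rw [direction_affineSpan, ← range_triple]
  exact h.finrank_vectorSpan (by simp)

theorem affineSpan_triple_eq_top {a b c : Plane} (h : AffineIndependent ℝ ![a, b, c]) :
    affineSpan ℝ {a, b, c} = ⊤ := by
  rw [← range_triple, h.affineSpan_eq_top_iff_card_eq_finrank_add_one]
  simp

/-- The parametrisation of the plane of the triangle is isometric, so that it carries Lebesgue
measure to the normalised Hausdorff measure. -/
theorem exists_affineIsometry {a b c : EuclideanSpace ℝ (Fin n)}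
    (h : AffineIndependent ℝ ![a, b, c]) :
    ∃ (ι : Plane →ᵃⁱ[ℝ] EuclideanSpace ℝ (Fin n)) (a' b' c' : Plane),
      AffineIndependent ℝ ![a', b', c'] ∧ ι a' = a ∧ ι b' = b ∧ ι c' = c := by
  set P := affineSpan ℝ ({a, b, c} : Set (EuclideanSpace ℝ (Fin n))) with hP
  have hd : finrank ℝ P.direction = 2 := finrank_direction_affineSpan h
  let B := (stdOrthonormalBasis ℝ P.direction).reindex (finCongr hd)
  let ι : Plane →ᵃⁱ[ℝ] EuclideanSpace ℝ (Fin n) :=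
    (AffineIsometryEquiv.constVAdd ℝ (EuclideanSpace ℝ (Fin n)) a).toAffineIsometry.comp
      (P.direction.subtypeₗᵢ.comp B.repr.symm.toLinearIsometry).toAffineIsometry
  have key : ∀ x ∈ P, ∃ x', ι x' = x := fun x hx => by
    have ha : a ∈ P := subset_affineSpan _ _ (by simp)
    refine ⟨B.repr ⟨x - a, AffineSubspace.vsub_mem_direction hx ha⟩, ?_⟩
    simp [ι]
  obtain ⟨a', ha⟩ := key a (subset_affineSpan _ _ (by simp))
  obtain ⟨b', hb⟩ := key b (subset_affineSpan _ _ (by simp))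
  obtain ⟨c', hc⟩ := key c (subset_affineSpan _ _ (by simp))
  refine ⟨ι, a', b', c', ?_, ha, hb, hc⟩
  refine (affineIndependent_map_triple ι.toAffineMap ι.injective).1 ?_
  have : ![ι a', ι b', ι c'] = ![a, b, c] := by rw [ha, hb, hc]
  exact this ▸ h

theorem image_openTriangle {m : ℕ}
    (ψ : EuclideanSpace ℝ (Fin m) →ᵃ[ℝ] EuclideanSpace ℝ (Fin n))
    (a b c : EuclideanSpace ℝ (Fin m)) :
    ψ '' openTriangle a b c = openTriangle (ψ a) (ψ b) (ψ c) := by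
  have key : ∀ r s t : ℝ, r + s + t = 1 →
      ψ (r • a + s • b + t • c) = r • ψ a + s • ψ b + t • ψ c := by
    intro r s t h
    obtain rfl : r = 1 - s - t := by linarith
    have h1 : (1 - s - t) • a + s • b + t • c = (s • (b - a) + t • (c - a)) +ᵥ a := by
      rw [vadd_eq_add]; module
    have h2 : ψ.linear (b - a) = ψ b - ψ a := ψ.linearMap_vsub b a
    have h3 : ψ.linear (c - a) = ψ c - ψ a := ψ.linearMap_vsub c a
    rw [h1, ψ.map_vadd, map_add, map_smul, map_smul, h2, h3, vadd_eq_add]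
    module
  ext y
  constructor
  · rintro ⟨x, ⟨r, s, t, hr, hs, ht, h, rfl⟩, rfl⟩
    exact ⟨r, s, t, hr, hs, ht, h, key r s t h⟩
  · rintro ⟨r, s, t, hr, hs, ht, h, rfl⟩
    exact ⟨_, ⟨r, s, t, hr, hs, ht, h, rfl⟩, key r s t h⟩

/-- The affine chart of the plane associated with a triangle. -/
def chart {V : Type*} [NormedAddCommGroup V] [NormedSpace ℝ V] (a b c : V) : ℝ × ℝ →ᵃ[ℝ] V where
  toFun q := a + q.1 • (b - a) + q.2 • (c - a)
  linear := (LinearMap.fst ℝ ℝ ℝ).smulRight (b - a) + (LinearMap.snd ℝ ℝ ℝ).smulRight (c - a)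
  map_vadd' p q := by
    simp only [vadd_eq_add, Prod.fst_add, Prod.snd_add, LinearMap.add_apply,
      LinearMap.smulRight_apply, LinearMap.fst_apply, LinearMap.snd_apply]
    module

theorem chart_apply {V : Type*} [NormedAddCommGroup V] [NormedSpace ℝ V] (a b c : V) (q : ℝ × ℝ) :
    chart a b c q = a + q.1 • (b - a) + q.2 • (c - a) := rfl

theorem chart_linear_apply {V : Type*} [NormedAddCommGroup V] [NormedSpace ℝ V] (a b c : V)
    (q : ℝ × ℝ) : (chart a b c).linear q = q.1 • (b - a) + q.2 • (c - a) := rfl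

theorem linearIndependent_of_triple {V : Type*} [NormedAddCommGroup V] [NormedSpace ℝ V]
    {a b c : V} : AffineIndependent ℝ ![a, b, c] ↔ LinearIndependent ℝ ![b - a, c - a] := by
  rw [affineIndependent_iff_linearIndependent_vsub ℝ _ (0 : Fin 3)]
  rw [← linearIndependent_equiv (finSuccAboveEquiv (0 : Fin 3))]
  congr! 1
  funext i
  fin_cases i <;> simp [finSuccAboveEquiv]

theorem chart_injective {V : Type*} [NormedAddCommGroup V] [NormedSpace ℝ V] {a b c : V}
    (h : AffineIndependent ℝ ![a, b, c]) : Function.Injective (chart a b c) := by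
  rw [← AffineMap.linear_injective_iff, injective_iff_map_eq_zero]
  intro q hq
  rw [chart_linear_apply] at hq
  have := LinearIndependent.pair_iff.1 (linearIndependent_of_triple.1 h) _ _ hq
  exact Prod.ext this.1 this.2

/-- The chart of a nondegenerate triangle of the plane, as an affine equivalence. -/
def chartEquiv {a b c : Plane} (h : AffineIndependent ℝ ![a, b, c]) : ℝ × ℝ ≃ᵃ[ℝ] Plane :=
  AffineEquiv.ofBijective (φ := chart a b c) <| by
    refine ⟨chart_injective h, ?_⟩
    rw [← AffineMap.linear_surjective_iff,
      ← LinearMap.injective_iff_surjective_of_finrank_eq_finrank (by simp),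
      AffineMap.linear_injective_iff]
    exact chart_injective h

theorem chartEquiv_apply {a b c : Plane} (h : AffineIndependent ℝ ![a, b, c]) (q : ℝ × ℝ) :
    chartEquiv h q = a + q.1 • (b - a) + q.2 • (c - a) := rfl

/-- The standard open triangle. -/
def stdTriangle : Set (ℝ × ℝ) := {q | 0 < q.1 ∧ 0 < q.2 ∧ q.1 + q.2 < 1}

theorem isOpen_stdTriangle : IsOpen stdTriangle :=
  (isOpen_lt continuous_const continuous_fst).inter
    ((isOpen_lt continuous_const continuous_snd).inter
      (isOpen_lt (continuous_fst.add continuous_snd) continuous_const))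

theorem chartEquiv_preimage_openTriangle {a b c : Plane} (h : AffineIndependent ℝ ![a, b, c]) :
    chartEquiv h ⁻¹' openTriangle a b c = stdTriangle := by
  ext q
  constructor
  · rintro ⟨r, s, t, hr, hs, ht, h1, h2⟩
    have : chartEquiv h q = chartEquiv h (s, t) := by
      rw [h2, chartEquiv_apply]
      obtain rfl : r = 1 - s - t := by linarith
      module
    rw [(chartEquiv h).injective this]
    exact ⟨hs, ht, by simp only; linarith⟩
  · rintro ⟨h1, h2, h3⟩
    refine ⟨1 - q.1 - q.2, q.1, q.2, by linarith, h1, h2, by ring, ?_⟩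
    rw [chartEquiv_apply]
    module

theorem isOpen_openTriangle {a b c : Plane} (h : AffineIndependent ℝ ![a, b, c]) :
    IsOpen (openTriangle a b c) := by
  have : openTriangle a b c = (chartEquiv h).symm ⁻¹' stdTriangle := by
    rw [← chartEquiv_preimage_openTriangle h, ← preimage_comp]
    simp [Function.comp_def]
  rw [this]
  exact isOpen_stdTriangle.preimage (AffineEquiv.continuous_of_finiteDimensional _)

theorem openTriangle_nonempty (a b c : EuclideanSpace ℝ (Fin n)) : (openTriangle a b c).Nonempty :=
  ⟨_, 1 / 3, 1 / 3, 1 / 3, by norm_num, by norm_num, by norm_num, by norm_num, rfl⟩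

theorem finsler_eq_hilbertNorm {C : Set (EuclideanSpace ℝ (Fin n))} (hC : IsConvexDomain C)
    (ι : Plane →ᵃⁱ[ℝ] EuclideanSpace ℝ (Fin n)) {x : Plane} (hx : ι x ∈ C) (v : Plane) :
    finsler (C ∩ range ι) (ι x) (ι.linear v) = hilbertNorm (ι ⁻¹' C) x v := by
  have ho : IsOpen (ι ⁻¹' C) := hC.isOpen.preimage ι.continuous
  have hc : Convex ℝ (ι ⁻¹' C) := hC.convex.affine_preimage ι.toAffineMap
  have hb : Bornology.IsBounded (ι ⁻¹' C) := by
    have := ι.isometry.antilipschitz.isBounded_preimage hC.isBounded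
    exact this
  have hset : ∀ w : Plane, {t : ℝ | ι x + t • ι.linear w ∈ C ∩ range ι} =
      {t : ℝ | x + t • w ∈ ι ⁻¹' C} := by
    intro w
    ext t
    have : ι (x + t • w) = ι x + t • ι.linear w := by
      have := ι.toAffineMap.map_vadd x (t • w)
      rwa [map_smul, vadd_eq_add, vadd_eq_add, add_comm, add_comm _ (ι.toAffineMap x)] at this
    simp only [mem_ofPred_eq, ← this, mem_inter_iff, mem_range_self, and_true, mem_preimage]
  -- For v = 0 the exit points carry no information, but the factor ‖v‖ vanishes.
  rcases eq_or_ne v 0 with rfl | hv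
  · rw [hilbertNorm_zero]
    simp [finsler]
  have key : ∀ w : Plane, w ≠ 0 → ‖ι.linear w‖ = ‖v‖ → ‖ι.linear v‖ *
      (1 / ‖ι x - exitPoint (C ∩ range ι) (ι x) (ι.linear w)‖) = exitRate (ι ⁻¹' C) x w := by
    intro w hw hwv
    obtain ⟨h1, h2⟩ := inv_exitTime ho hc hb hx hw
    have hnv : ‖ι.linear v‖ = ‖v‖ := ι.linearIsometry.norm_map v
    rw [exitPoint, hset, sub_add_cancel_left, norm_neg, norm_smul, hwv, hnv, ← h2,
      Real.norm_of_nonneg h1.le]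
    have := norm_pos_iff.2 hv
    field_simp
  have h1 := key v hv (ι.linearIsometry.norm_map v)
  have h2 := key (-v) (by simpa using hv)
    ((ι.linearIsometry.norm_map (-v)).trans (norm_neg v))
  rw [map_neg] at h2
  rw [hilbertNorm, ← h1, ← h2, finsler]
  ring

/-- On the plane of the triangle, the 2-dimensional Hausdorff measure is the image of Lebesgue
measure under ι, and the Finsler balls are the images of the planar Hilbert balls. -/
theorem triangleArea_eq_hilbertArea {C : Set (EuclideanSpace ℝ (Fin n))} (hC : IsConvexDomain C)
    (ι : Plane →ᵃⁱ[ℝ] EuclideanSpace ℝ (Fin n)) {a b c : Plane}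
    (h : AffineIndependent ℝ ![a, b, c]) (hT : openTriangle (ι a) (ι b) (ι c) ⊆ C) :
    triangleArea C (ι a) (ι b) (ι c) = hilbertArea volume (ι ⁻¹' C) (openTriangle a b c) := by
  have hi : AffineIndependent ℝ ![ι a, ι b, ι c] :=
    (affineIndependent_map_triple ι.toAffineMap ι.injective).2 h
  set P := affineSpan ℝ {ι a, ι b, ι c} with hP
  have hPι : P = AffineSubspace.map ι.toAffineMap ⊤ := by
    rw [← affineSpan_triple_eq_top h, AffineSubspace.map_span, hP]
    congr 1
    simp [image_insert_eq]
  have hPr : (P : Set (EuclideanSpace ℝ (Fin n))) = range ι := by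
    rw [hPι, AffineSubspace.coe_map]
    simp
  have hdir : ∀ w, w ∈ P.direction ↔ ∃ v, ι.linear v = w := by
    intro w
    rw [hPι, AffineSubspace.map_direction]
    simp
  have hrank : finrank ℝ P.direction = 2 := finrank_direction_affineSpan hi
  have htri : openTriangle (ι a) (ι b) (ι c) = ι '' openTriangle a b c :=
    (image_openTriangle ι.toAffineMap a b c).symm
  have hemb : MeasurableEmbedding ι := ι.isometry.isClosedEmbedding.measurableEmbedding
  have hmeas : MeasurableSet (openTriangle (ι a) (ι b) (ι c)) := by
    rw [htri]
    exact hemb.measurableSet_image.2 (isOpen_openTriangle h).measurableSet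
  have hsub : openTriangle (ι a) (ι b) (ι c) ⊆ C ∩ P :=
    subset_inter hT (by rw [hPr, htri]; exact image_subset_range _ _)
  have hmap : (volume : Measure Plane).map ι = (μHE[2]).restrict (range ι) := by
    rw [← EuclideanSpace.euclideanHausdorffMeasure_eq_volume]
    exact ι.isometry.map_euclideanHausdorffMeasure
  unfold triangleArea hilbertMeasure density
  rw [← hP, withDensity_apply _ hmeas, Measure.restrict_restrict hmeas,
    inter_eq_left.2 hsub, volume_ball_of_eq_two hrank, hrank]
  have hr : (μHE[2] : Measure (EuclideanSpace ℝ (Fin n))).restrict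
      (openTriangle (ι a) (ι b) (ι c)) =
      ((volume : Measure Plane).map ι).restrict (openTriangle (ι a) (ι b) (ι c)) := by
    rw [hmap, Measure.restrict_restrict hmeas, inter_eq_left.2]
    rw [htri]
    exact image_subset_range _ _
  rw [hr, hemb.restrict_map, hemb.lintegral_map, htri, preimage_image_eq _ ι.injective]
  refine setLIntegral_congr_fun (isOpen_openTriangle h).measurableSet fun x hx => ?_
  have hxC : ι x ∈ C := hT (by rw [htri]; exact mem_image_of_mem _ hx)
  have hball : finslerBall C P (ι x) = ι.linearIsometry '' {v | hilbertNorm (ι ⁻¹' C) x v < 1} := by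
    ext w
    rw [finslerBall, hPr]
    constructor
    · rintro ⟨h1, h2⟩
      obtain ⟨v, rfl⟩ := (hdir w).1 h1
      rw [finsler_eq_hilbertNorm hC ι hxC] at h2
      exact ⟨v, h2, rfl⟩
    · rintro ⟨v, h1, rfl⟩
      refine ⟨(hdir _).2 ⟨v, rfl⟩, ?_⟩
      exact (finsler_eq_hilbertNorm hC ι hxC v).trans_lt h1
  simp only [hball]
  rw [ι.linearIsometry.isometry.euclideanHausdorffMeasure_image,
    EuclideanSpace.euclideanHausdorffMeasure_eq_volume]

/-! ### Ideal triangles of the ball: the hyperbolic area π. -/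

section Ball

variable {V : Type*} [NormedAddCommGroup V] [InnerProductSpace ℝ V]

/-- With l = ⟨y, w⟩ and G = 1 - ‖y‖², a rate r > 0 is admissible exactly when G r² - 2 l r - ‖w‖² >
0; the formula is the larger root. -/
theorem exitRate_ball {y : V} (hy : ‖y‖ < 1) (w : V) :
    exitRate (Metric.ball (0 : V) 1) y w =
      (inner ℝ y w + √((inner ℝ y w) ^ 2 + (1 - ‖y‖ ^ 2) * ‖w‖ ^ 2)) / (1 - ‖y‖ ^ 2) := by
  set l := inner ℝ y w
  set G := 1 - ‖y‖ ^ 2 with hG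
  have hG0 : 0 < G := by have := norm_nonneg y; nlinarith
  set q := √(l ^ 2 + G * ‖w‖ ^ 2) with hq
  have hnn : 0 ≤ l ^ 2 + G * ‖w‖ ^ 2 := by positivity
  have hq2 : q ^ 2 = l ^ 2 + G * ‖w‖ ^ 2 := Real.sq_sqrt hnn
  have hql : |l| ≤ q := by
    rw [hq, ← Real.sqrt_sq_eq_abs]
    exact Real.sqrt_le_sqrt (by nlinarith [sq_nonneg ‖w‖])
  have hl1 := (abs_le.1 hql).1
  have hl2 := (abs_le.1 hql).2
  rw [exitRate_eq_sInf]
  have : {r : ℝ | 0 < r ∧ y + r⁻¹ • w ∈ Metric.ball (0 : V) 1} = Ioi ((l + q) / G) := by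
    ext r
    have h1 : 0 < r → (y + r⁻¹ • w ∈ Metric.ball (0 : V) 1 ↔ (l + q) / G < r) := by
      intro hr
      have h2 : ‖y + r⁻¹ • w‖ ^ 2 = 1 - G + (2 * r * l + ‖w‖ ^ 2) / r ^ 2 := by
        rw [norm_add_sq_real, inner_smul_right, norm_smul, Real.norm_of_nonneg (inv_pos.2 hr).le]
        field_simp
        ring
      rw [mem_ball_zero_iff, ← sq_lt_one_iff₀ (norm_nonneg _), h2, div_lt_iff₀ hG0]
      have h3 : 1 - G + (2 * r * l + ‖w‖ ^ 2) / r ^ 2 < 1 ↔ 2 * r * l + ‖w‖ ^ 2 < G * r ^ 2 := by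
        rw [← div_lt_iff₀ (by positivity)]
        constructor <;> intro h <;> linarith
      rw [h3, ← sub_pos, ← mul_pos_iff_of_pos_left hG0]
      have h4 : G * (G * r ^ 2 - (2 * r * l + ‖w‖ ^ 2)) = (r * G - (l + q)) * (r * G + (q - l)) := by
        linear_combination hq2
      rw [h4, mul_pos_iff_of_pos_right (by have := mul_pos hr hG0; linarith), sub_pos]
    constructor
    · rintro ⟨hr, h⟩
      exact (h1 hr).1 h
    · intro h
      have hr : 0 < r := lt_of_le_of_lt (div_nonneg (by linarith) hG0.le) h
      exact ⟨hr, (h1 hr).2 h⟩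
  rw [this, csInf_Ioi]

theorem hilbertNorm_ball {y : V} (hy : ‖y‖ < 1) (w : V) :
    hilbertNorm (Metric.ball (0 : V) 1) y w =
      √((inner ℝ y w) ^ 2 + (1 - ‖y‖ ^ 2) * ‖w‖ ^ 2) / (1 - ‖y‖ ^ 2) := by
  rw [hilbertNorm, exitRate_ball hy, exitRate_ball hy, inner_neg_right, norm_neg, neg_sq]
  ring

/-- The square root cancels in the odd part, leaving a linear function of w. This serves the study
of plane sections. -/
theorem exitRate_sub_ball {y : V} (hy : ‖y‖ < 1) (w : V) :
    (exitRate (Metric.ball (0 : V) 1) y w - exitRate (Metric.ball (0 : V) 1) y (-w)) / 2 =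
      inner ℝ y w / (1 - ‖y‖ ^ 2) := by
  rw [exitRate_ball hy, exitRate_ball hy, inner_neg_right, norm_neg, neg_sq]
  ring

end Ball

theorem volume_disc : volume {q : ℝ × ℝ | q.1 ^ 2 + q.2 ^ 2 < 1} = ENNReal.ofReal Real.pi := by
  have h := Complex.volume_preserving_equiv_real_prod
  rw [← h.measure_preimage_equiv]
  have : Complex.measurableEquivRealProd ⁻¹' {q : ℝ × ℝ | q.1 ^ 2 + q.2 ^ 2 < 1} =
      Metric.ball (0 : ℂ) 1 := by
    ext z
    rw [mem_ball_zero_iff, ← sq_lt_one_iff₀ (norm_nonneg z), ← Complex.normSq_eq_norm_sq,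
      Complex.normSq_apply]
    simp [Complex.measurableEquivRealProd, sq]
  rw [this, Complex.volume_ball]
  simp [ENNReal.ofReal, NNReal.pi, Real.toNNReal_of_nonneg Real.pi_pos.le]
  rfl

theorem det_finTwoProd (a b c d : ℝ) :
    LinearMap.det (Matrix.toLin (Basis.finTwoProd ℝ) (Basis.finTwoProd ℝ) !![a, b; c, d]) =
      a * d - b * c := by
  rw [LinearMap.det_toLin, Matrix.det_fin_two_of]

/-- Completing the square gives a triangular linear map of determinant √(AC - B²) / k² that sends
the ellipse to the unit disc. -/
theorem volume_ellipse {A B C k : ℝ} (hA : 0 < A) (hdet : 0 < A * C - B ^ 2) (hk : 0 < k) :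
    volume {v : ℝ × ℝ | A * v.1 ^ 2 + 2 * B * (v.1 * v.2) + C * v.2 ^ 2 < k ^ 2} =
      ENNReal.ofReal (k ^ 2 / √(A * C - B ^ 2) * Real.pi) := by
  set s := √A
  set d := √(A * C - B ^ 2)
  have hs : 0 < s := Real.sqrt_pos.2 hA
  have hd : 0 < d := Real.sqrt_pos.2 hdet
  have hs2 : s ^ 2 = A := Real.sq_sqrt hA.le
  have hd2 : d ^ 2 = A * C - B ^ 2 := Real.sq_sqrt hdet.le
  let L := Matrix.toLin (Basis.finTwoProd ℝ) (Basis.finTwoProd ℝ)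
    !![s / k, B / (s * k); 0, d / (s * k)]
  have hL : LinearMap.det L = d / k ^ 2 := by
    rw [det_finTwoProd]
    field_simp
    ring
  have hpre : {v : ℝ × ℝ | A * v.1 ^ 2 + 2 * B * (v.1 * v.2) + C * v.2 ^ 2 < k ^ 2} =
      L ⁻¹' {q : ℝ × ℝ | q.1 ^ 2 + q.2 ^ 2 < 1} := by
    ext v
    have h1 : (s / k * v.1 + B / (s * k) * v.2) ^ 2 + (d / (s * k) * v.2) ^ 2 =
        (A * v.1 ^ 2 + 2 * B * (v.1 * v.2) + C * v.2 ^ 2) / k ^ 2 := by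
      field_simp
      rw [hd2, ← hs2]
      ring
    simp only [L, mem_ofPred_eq, mem_preimage, Matrix.toLin_finTwoProd_apply]
    rw [zero_mul, zero_add, h1, div_lt_one (by positivity)]
  rw [hpre, Measure.addHaar_preimage_linearMap _ (by rw [hL]; positivity), volume_disc, hL,
    abs_of_pos (by positivity), inv_div, ENNReal.ofReal_mul (by positivity)]

/-- The integrands used later may blow up at the endpoints. Nonnegativity of the derivative and
continuity of the primitive up to the ends supply integrability. -/
theorem lintegral_Ioo_of_hasDerivAt {F f : ℝ → ℝ} {a b : ℝ} (hab : a ≤ b)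
    (hF : ContinuousOn F (Icc a b)) (hd : ∀ x ∈ Ioo a b, HasDerivAt F (f x) x)
    (hf : ∀ x ∈ Ioo a b, 0 ≤ f x) :
    ∫⁻ x in Ioo a b, ENNReal.ofReal (f x) = ENNReal.ofReal (F b - F a) := by
  have hi := intervalIntegral.integrableOn_deriv_of_nonneg hF hd hf
  have hI := intervalIntegral.integral_eq_sub_of_hasDerivAt_of_le hab hF hd
    ((intervalIntegrable_iff_integrableOn_Ioc_of_le hab).2 hi)
  rw [← hI, intervalIntegral.integral_of_le hab, integral_Ioc_eq_integral_Ioo,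
    ofReal_integral_eq_lintegral_ofReal (hi.mono_set Ioo_subset_Ioc_self)]
  exact (ae_restrict_iff' measurableSet_Ioo).2 (Eventually.of_forall hf)

theorem lintegral_Ioo_zero_mul {c : ℝ} (hc : 0 < c) (f : ℝ → ENNReal) :
    ∫⁻ t in Ioo 0 c, f t = ∫⁻ y in Ioo 0 1, ENNReal.ofReal c * f (c * y) := by
  have h := lintegral_image_eq_lintegral_abs_deriv_mul (s := Ioo (0 : ℝ) 1) (f := fun y => c * y)
    (f' := fun _ => c) measurableSet_Ioo
    (fun x _ => by simpa using ((hasDerivAt_id x).const_mul c).hasDerivWithinAt)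
    (fun x _ y _ h => mul_left_cancel₀ hc.ne' h) f
  have himg : (fun y => c * y) '' Ioo (0 : ℝ) 1 = Ioo 0 c := by
    rw [image_mul_left_Ioo hc, mul_zero, mul_one]
  rw [himg] at h
  rw [h, abs_of_pos hc]

/-- The substitution t = (1 - s) y sweeps the triangle by segments issued from the vertex (1, 0),
and the inner integral runs along them. -/
theorem lintegral_stdTriangle {g : ℝ × ℝ → ENNReal} (hg : Measurable g) :
    ∫⁻ q in stdTriangle, g q =
      ∫⁻ y in Ioo (0 : ℝ) 1, ∫⁻ s in Ioo (0 : ℝ) 1,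
        ENNReal.ofReal (1 - s) * g (s, (1 - s) * y) := by
  have hT := isOpen_stdTriangle.measurableSet
  rw [← lintegral_indicator hT, Measure.volume_eq_prod,
    lintegral_prod _ (hg.indicator hT).aemeasurable]
  have h1 : ∀ s : ℝ, ∫⁻ t, stdTriangle.indicator g (s, t) = (Ioo (0 : ℝ) 1).indicator
      (fun s => ∫⁻ y in Ioo (0 : ℝ) 1, ENNReal.ofReal (1 - s) * g (s, (1 - s) * y)) s := by
    intro s
    by_cases hs : s ∈ Ioo (0 : ℝ) 1
    · rw [indicator_of_mem hs, ← lintegral_Ioo_zero_mul (f := fun t => g (s, t))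
        (by linarith [hs.2]), ← lintegral_indicator measurableSet_Ioo]
      refine lintegral_congr fun t => ?_
      have : (s, t) ∈ stdTriangle ↔ t ∈ Ioo 0 (1 - s) := by
        constructor
        · rintro ⟨-, h2, h3⟩
          exact ⟨h2, by simp only at h3; linarith⟩
        · rintro ⟨h2, h3⟩
          exact ⟨hs.1, h2, by simp only; linarith⟩
      by_cases ht : t ∈ Ioo 0 (1 - s)
      · rw [indicator_of_mem ht, indicator_of_mem (this.2 ht)]
      · rw [indicator_of_notMem ht, indicator_of_notMem (mt this.1 ht)]
    · rw [indicator_of_notMem hs, ← lintegral_zero]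
      refine lintegral_congr fun t => indicator_of_notMem ?_ g
      rintro ⟨h1, h2, h3⟩
      simp only at h1 h2 h3
      exact hs ⟨h1, by linarith⟩
  simp only [h1]
  rw [lintegral_indicator measurableSet_Ioo, lintegral_lintegral_swap]
  exact Measurable.aemeasurable (by fun_prop)

/-- The integral over the standard triangle of the hyperbolic density, for a circumscribed conic
whose equation has barycentric coefficients `α`, `β`, `γ`. -/
theorem lintegral_conic {α β γ : ℝ} (hα : 0 < α) (hβ : 0 < β) (hγ : 0 < γ) :
    ∫⁻ q in stdTriangle, ENNReal.ofReal
      (√((α * (q.1 * q.2) + β * (q.2 * (1 - q.1 - q.2)) + γ * (q.1 * (1 - q.1 - q.2))) *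
        (α * β * γ) / 4) /
      (α * (q.1 * q.2) + β * (q.2 * (1 - q.1 - q.2)) + γ * (q.1 * (1 - q.1 - q.2))) ^ 2) =
    ENNReal.ofReal Real.pi := by
  rw [lintegral_stdTriangle (by fun_prop)]
  set c := √(α * β * γ) with hc
  have hc0 : 0 < c := Real.sqrt_pos.2 (by positivity)
  have hc2 : c ^ 2 = α * β * γ := Real.sq_sqrt (by positivity)
  have inner : ∀ y ∈ Ioo (0 : ℝ) 1, ∫⁻ s in Ioo (0 : ℝ) 1, ENNReal.ofReal (1 - s) *
      ENNReal.ofReal (√((α * (s * ((1 - s) * y)) + β * ((1 - s) * y * (1 - s - (1 - s) * y)) +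
        γ * (s * (1 - s - (1 - s) * y))) * (α * β * γ) / 4) /
      (α * (s * ((1 - s) * y)) + β * ((1 - s) * y * (1 - s - (1 - s) * y)) +
        γ * (s * (1 - s - (1 - s) * y))) ^ 2) =
      ENNReal.ofReal (c / (α * y + γ * (1 - y)) * √(1 / (β * (y * (1 - y))))) := by
    rintro y ⟨hy0, hy1⟩
    have hy1' : 0 < 1 - y := by linarith
    set k := α * y + γ * (1 - y) with hk
    set m := β * (y * (1 - y)) with hm
    have hk0 : 0 < k := by positivity
    have hm0 : 0 < m := by positivity
    have hH : ∀ s ∈ Icc (0 : ℝ) 1, 0 < s * k + (1 - s) * m := by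
      rintro s ⟨h0, h1⟩
      rcases h0.eq_or_lt with rfl | h0
      · linarith
      · have := mul_pos h0 hk0
        have := mul_nonneg (sub_nonneg.2 h1) hm0.le
        linarith
    have hcongr : ∀ s ∈ Ioo (0 : ℝ) 1, ENNReal.ofReal (1 - s) *
      ENNReal.ofReal (√((α * (s * ((1 - s) * y)) + β * ((1 - s) * y * (1 - s - (1 - s) * y)) +
        γ * (s * (1 - s - (1 - s) * y))) * (α * β * γ) / 4) /
      (α * (s * ((1 - s) * y)) + β * ((1 - s) * y * (1 - s - (1 - s) * y)) +
        γ * (s * (1 - s - (1 - s) * y))) ^ 2) =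
        ENNReal.ofReal (-(c / k) * (-k / (s * k + (1 - s) * m) ^ 2 /
          (2 * √((1 - s) / (s * k + (1 - s) * m))))) := by
      rintro s ⟨h0, h1⟩
      have h1' : 0 < 1 - s := by linarith
      have hHs := hH s ⟨h0.le, h1.le⟩
      rw [← ENNReal.ofReal_mul h1'.le]
      congr 1
      -- The conic passes through the vertex (1, 0), so on a segment from it the equation splits off
      -- the factor 1 - s and leaves a factor affine in s.
      have e1 : α * (s * ((1 - s) * y)) + β * ((1 - s) * y * (1 - s - (1 - s) * y)) +
        γ * (s * (1 - s - (1 - s) * y)) = (1 - s) * (s * k + (1 - s) * m) := by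
        rw [hk, hm]; ring
      rw [e1]
      set H := s * k + (1 - s) * m
      have e2 : √((1 - s) * H * (α * β * γ) / 4) = √((1 - s) / H) * H * c / 2 := by
        rw [Real.sqrt_eq_iff_mul_self_eq_of_pos (by positivity), ← sq, div_pow, mul_pow, mul_pow,
          Real.sq_sqrt (by positivity), hc2]
        field_simp
        norm_num
      rw [e2]
      set u := √((1 - s) / H) with hu
      have hu0 : 0 < u := Real.sqrt_pos.2 (by positivity)
      have hu2 : u ^ 2 * H = 1 - s := by
        rw [hu, Real.sq_sqrt (by positivity)]
        field_simp
      rw [← hu2]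
      field_simp
    rw [setLIntegral_congr_fun measurableSet_Ioo hcongr]
    -- The primitive vanishes at s = 1, so only the value at s = 0, where the affine factor equals
    -- m, contributes.
    rw [lintegral_Ioo_of_hasDerivAt
      (F := fun s => -(c / k) * √((1 - s) / (s * k + (1 - s) * m))) zero_le_one]
    · congr 1
      simp
    · have : ContinuousOn (fun s => (1 - s) / (s * k + (1 - s) * m)) (Icc (0 : ℝ) 1) :=
        ContinuousOn.div (by fun_prop) (by fun_prop) fun s hs => (hH s hs).ne'
      fun_prop
    · rintro s ⟨h0, h1⟩
      have hHs := hH s ⟨h0.le, h1.le⟩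
      have h1' : 0 < 1 - s := by linarith
      refine HasDerivAt.const_mul _ (HasDerivAt.sqrt ?_ (by positivity))
      have hn : HasDerivAt (fun s : ℝ => 1 - s) (-1) s := by
        simpa using (hasDerivAt_id s).const_sub 1
      have hd : HasDerivAt (fun s : ℝ => s * k + (1 - s) * m) (1 * k + -1 * m) s :=
        ((hasDerivAt_id s).mul_const k).add (hn.mul_const m)
      refine (hn.div hd hHs.ne').congr_deriv ?_
      congr 1
      ring
    · rintro s ⟨h0, h1⟩
      have hHs := hH s ⟨h0.le, h1.le⟩
      have e : -(c / k) * (-k / (s * k + (1 - s) * m) ^ 2 /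
          (2 * √((1 - s) / (s * k + (1 - s) * m)))) = (c / k) * (k / (s * k + (1 - s) * m) ^ 2 /
          (2 * √((1 - s) / (s * k + (1 - s) * m)))) := by ring
      rw [e]
      positivity
  rw [setLIntegral_congr_fun measurableSet_Ioo inner]
  have hk : ∀ y ∈ Icc (0 : ℝ) 1, 0 < α * y + γ * (1 - y) := by
    rintro y ⟨h0, h1⟩
    rcases h0.eq_or_lt with rfl | h0
    · linarith
    · have := mul_pos hα h0
      have := mul_nonneg hγ.le (sub_nonneg.2 h1)
      linarith
  have hw : ∀ y ∈ Ioo (0 : ℝ) 1, 0 < 1 - ((γ * (1 - y) - α * y) / (α * y + γ * (1 - y))) ^ 2 ∧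
      √(1 - ((γ * (1 - y) - α * y) / (α * y + γ * (1 - y))) ^ 2) =
        2 * (α * γ) / c * √(β * (y * (1 - y))) / (α * y + γ * (1 - y)) := by
    rintro y ⟨h0, h1⟩
    have hk0 := hk y ⟨h0.le, h1.le⟩
    have h1' : 0 < 1 - y := by linarith
    have e : 1 - ((γ * (1 - y) - α * y) / (α * y + γ * (1 - y))) ^ 2 =
        4 * (α * γ) * (y * (1 - y)) / (α * y + γ * (1 - y)) ^ 2 := by
      field_simp
      ring
    refine ⟨by rw [e]; positivity, ?_⟩
    rw [e, Real.sqrt_eq_iff_mul_self_eq_of_pos (by positivity), ← sq, div_pow, mul_pow, Real.sq_sqrt (by positivity),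
      div_pow, hc2]
    field_simp
    norm_num
  -- The argument of the arccosine goes from 1 at y = 0 to -1 at y = 1, which yields π.
  rw [lintegral_Ioo_of_hasDerivAt
    (F := fun y => Real.arccos ((γ * (1 - y) - α * y) / (α * y + γ * (1 - y)))) zero_le_one]
  · congr 1
    simp [hα.ne', hγ.ne']
  · have : ContinuousOn (fun y => (γ * (1 - y) - α * y) / (α * y + γ * (1 - y))) (Icc (0 : ℝ) 1) :=
      ContinuousOn.div (by fun_prop) (by fun_prop) fun s hs => (hk s hs).ne'
    exact Real.continuous_arccos.comp_continuousOn this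
  · rintro y ⟨h0, h1⟩
    obtain ⟨hw1, hw2⟩ := hw y ⟨h0, h1⟩
    have hk0 := hk y ⟨h0.le, h1.le⟩
    have h1' : 0 < 1 - y := by linarith
    have hn : HasDerivAt (fun y : ℝ => γ * (1 - y) - α * y) (γ * (-1) - α * 1) y :=
      (((hasDerivAt_id y).const_sub 1).const_mul γ).sub ((hasDerivAt_id y).const_mul α)
    have hd : HasDerivAt (fun y : ℝ => α * y + γ * (1 - y)) (α * 1 + γ * (-1)) y :=
      ((hasDerivAt_id y).const_mul α).add (((hasDerivAt_id y).const_sub 1).const_mul γ)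
    have hne : ∀ x : ℝ, 0 < 1 - x ^ 2 → x ≠ -1 ∧ x ≠ 1 := by
      rintro x hx
      constructor <;> rintro rfl <;> norm_num at hx
    obtain ⟨hne1, hne2⟩ := hne _ hw1
    refine ((Real.hasDerivAt_arccos hne1 hne2).comp y (hn.div hd hk0.ne')).congr_deriv ?_
    rw [hw2, Real.sqrt_div zero_le_one, Real.sqrt_one]
    have : 0 < √(β * (y * (1 - y))) := Real.sqrt_pos.2 (by positivity)
    field_simp
    ring
  · rintro y ⟨h0, h1⟩
    have hk0 := hk y ⟨h0.le, h1.le⟩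
    positivity

/-- In barycentric coordinates 1 - ‖x‖² is the conic form whose coefficients are the squared side
lengths. The unit ball of the norm is an ellipse, whose discriminant reduces the density to the one
in `lintegral_conic`. The ambient space may have any dimension. -/
theorem hilbertArea_chart_ball {V : Type*} [NormedAddCommGroup V] [InnerProductSpace ℝ V]
    {a b c : V} (ha : ‖a‖ = 1) (hb : ‖b‖ = 1) (hc : ‖c‖ = 1)
    (h : AffineIndependent ℝ ![a, b, c]) :
    hilbertArea volume (chart a b c ⁻¹' Metric.ball 0 1) stdTriangle = ENNReal.ofReal Real.pi := by
  have hab : a ≠ b := fun e => by simpa using h.injective.ne (by decide : (0 : Fin 3) ≠ 1) e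
  have hbc : b ≠ c := fun e => by simpa using h.injective.ne (by decide : (1 : Fin 3) ≠ 2) e
  have hca : c ≠ a := fun e => by simpa using h.injective.ne (by decide : (2 : Fin 3) ≠ 0) e
  have hα : 0 < ‖b - c‖ ^ 2 := by have := norm_pos_iff.2 (sub_ne_zero.2 hbc); positivity
  have hβ : 0 < ‖c - a‖ ^ 2 := by have := norm_pos_iff.2 (sub_ne_zero.2 hca); positivity
  have hγ : 0 < ‖a - b‖ ^ 2 := by have := norm_pos_iff.2 (sub_ne_zero.2 hab); positivity
  have haa : inner ℝ a a = 1 := by rw [real_inner_self_eq_norm_sq, ha]; norm_num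
  have hbb : inner ℝ b b = 1 := by rw [real_inner_self_eq_norm_sq, hb]; norm_num
  have hcc : inner ℝ c c = 1 := by rw [real_inner_self_eq_norm_sq, hc]; norm_num
  set x := inner ℝ a b with hx
  set y := inner ℝ a c with hy
  set z := inner ℝ b c with hz
  have hx' : inner ℝ b a = x := real_inner_comm _ _
  have hy' : inner ℝ c a = y := real_inner_comm _ _
  have hz' : inner ℝ c b = z := real_inner_comm _ _
  have hα' : ‖b - c‖ ^ 2 = 2 - 2 * z := by rw [norm_sub_sq_real, hb, hc]; ring
  have hβ' : ‖c - a‖ ^ 2 = 2 - 2 * y := by rw [norm_sub_sq_real, hc, ha, hy']; ring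
  have hγ' : ‖a - b‖ ^ 2 = 2 - 2 * x := by rw [norm_sub_sq_real, ha, hb]; ring
  rw [hα'] at hα
  rw [hβ'] at hβ
  rw [hγ'] at hγ
  rw [← lintegral_conic hα hβ hγ, hilbertArea]
  refine setLIntegral_congr_fun isOpen_stdTriangle.measurableSet fun q hq => ?_
  obtain ⟨h1, h2, h3⟩ := hq
  set s := q.1
  set t := q.2
  have hr : 0 < 1 - s - t := by linarith
  set G := (2 - 2 * z) * (s * t) + (2 - 2 * y) * (t * (1 - s - t)) +
    (2 - 2 * x) * (s * (1 - s - t)) with hG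
  have hG0 : 0 < G := by positivity
  have hGq : 1 - ‖chart a b c q‖ ^ 2 = G := by
    rw [← real_inner_self_eq_norm_sq, chart_apply]
    simp only [inner_add_left, inner_add_right, inner_smul_left, inner_smul_right, inner_sub_left,
      inner_sub_right, haa, hbb, hcc, hx', hy', hz', ← hx, ← hy, ← hz, conj_trivial]
    ring
  have hlt : ‖chart a b c q‖ < 1 := by
    rw [← sq_lt_one_iff₀ (norm_nonneg _)]; linarith
  set e := -(1 - x) + s * (2 - 2 * x) + t * (z - x - y + 1) with he
  set f := -(1 - y) + s * (z - x - y + 1) + t * (2 - 2 * y) with hf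
  have hin : ∀ v : ℝ × ℝ, inner ℝ (chart a b c q) ((chart a b c).linear v) =
      v.1 * e + v.2 * f := by
    intro v
    rw [chart_apply, chart_linear_apply]
    simp only [inner_add_left, inner_add_right, inner_smul_left, inner_smul_right, inner_sub_left,
      inner_sub_right, haa, hbb, hcc, hx', hy', hz', ← hx, ← hy, ← hz, conj_trivial]
    ring
  have hnorm : ∀ v : ℝ × ℝ, ‖(chart a b c).linear v‖ ^ 2 =
      (2 - 2 * x) * v.1 ^ 2 + 2 * (z - x - y + 1) * (v.1 * v.2) + (2 - 2 * y) * v.2 ^ 2 := by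
    intro v
    rw [← real_inner_self_eq_norm_sq, chart_linear_apply]
    simp only [inner_add_left, inner_add_right, inner_smul_left, inner_smul_right, inner_sub_left,
      inner_sub_right, haa, hbb, hcc, hx', hy', hz', ← hx, ← hy, ← hz, conj_trivial]
    ring
  set A := e ^ 2 + G * (2 - 2 * x)
  set B := e * f + G * (z - x - y + 1)
  set C := f ^ 2 + G * (2 - 2 * y)
  have hdet : A * C - B ^ 2 = G * ((2 - 2 * z) * (2 - 2 * y) * (2 - 2 * x)) / 4 := by
    simp only [A, B, C, he, hf, hG]
    ring
  have hA : 0 < A := by positivity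
  have hdet0 : 0 < A * C - B ^ 2 := by rw [hdet]; positivity
  have hset : {v | hilbertNorm (chart a b c ⁻¹' Metric.ball 0 1) q v < 1} =
      {v : ℝ × ℝ | A * v.1 ^ 2 + 2 * B * (v.1 * v.2) + C * v.2 ^ 2 < G ^ 2} := by
    ext v
    simp only [mem_ofPred_eq]
    rw [hilbertNorm_preimage, hilbertNorm_ball hlt, hGq, hin, hnorm, div_lt_one hG0,
      Real.sqrt_lt' hG0]
    simp only [A, B, C]
    constructor <;> intro h <;> linarith
  rw [hset, volume_ellipse hA hdet0 hG0, ← ENNReal.ofReal_div_of_pos (by positivity), hdet]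
  congr 1
  have h5 : 0 < √(G * ((2 - 2 * z) * (2 - 2 * y) * (2 - 2 * x)) / 4) :=
    Real.sqrt_pos.2 (by positivity)
  have := Real.pi_pos
  field_simp

theorem map_chart {V W : Type*} [NormedAddCommGroup V] [NormedSpace ℝ V]
    [NormedAddCommGroup W] [NormedSpace ℝ W] (ψ : V →ᵃ[ℝ] W) (a b c : V) (q : ℝ × ℝ) :
    ψ (chart a b c q) = chart (ψ a) (ψ b) (ψ c) q := by
  have h1 : chart a b c q = (q.1 • (b - a) + q.2 • (c - a)) +ᵥ a := by
    rw [chart_apply, vadd_eq_add]; abel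
  have h2 : ψ.linear (b - a) = ψ b - ψ a := ψ.linearMap_vsub b a
  have h3 : ψ.linear (c - a) = ψ c - ψ a := ψ.linearMap_vsub c a
  rw [h1, ψ.map_vadd, map_add, map_smul, map_smul, h2, h3, vadd_eq_add, chart_apply]
  abel

theorem hilbertArea_preimage_ball {V : Type*} [NormedAddCommGroup V] [InnerProductSpace ℝ V]
    (ψ : Plane →ᵃ[ℝ] V) (hψ : Function.Injective ψ) {a b c : Plane}
    (h : AffineIndependent ℝ ![a, b, c]) (ha : ‖ψ a‖ = 1) (hb : ‖ψ b‖ = 1) (hc : ‖ψ c‖ = 1) :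
    hilbertArea volume (ψ ⁻¹' Metric.ball 0 1) (openTriangle a b c) =
      ENNReal.ofReal Real.pi := by
  rw [← hilbertArea_chart_ball ha hb hc ((affineIndependent_map_triple ψ hψ).2 h),
    ← hilbertArea_preimage volume volume (chartEquiv h), chartEquiv_preimage_openTriangle]
  congr 1
  ext q
  simp only [mem_preimage, ← map_chart]
  rfl

/-- The plane embedding followed by the inverse of A is a single affine map into the space of the
unit ball, so the section need not first be recognised as an ellipse. -/
theorem triangleArea_of_isEllipsoid {C : Set (EuclideanSpace ℝ (Fin n))} (hC : IsConvexDomain C)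
    (hE : IsEllipsoid C) {a b c : EuclideanSpace ℝ (Fin n)} (h : IsIdealTriangle C a b c) :
    triangleArea C a b c = ENNReal.ofReal Real.pi := by
  obtain ⟨A, rfl⟩ := hE
  obtain ⟨ι, a', b', c', hi, rfl, rfl, rfl⟩ := exists_affineIsometry h.affineIndependent
  rw [triangleArea_eq_hilbertArea hC ι hi h.triangle_subset]
  have hpre : ι ⁻¹' (A '' Metric.ball 0 1) =
      (A.symm.toAffineMap.comp ι.toAffineMap) ⁻¹' Metric.ball 0 1 := by
    ext x
    simp only [mem_preimage, mem_image]
    constructor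
    · rintro ⟨y, hy, hyx⟩
      have : A.symm (ι x) = y := by rw [← hyx]; simp
      simpa [this] using hy
    · intro hx
      exact ⟨A.symm (ι x), by simpa using hx, by simp⟩
  have hfr : ∀ x ∈ frontier (A '' Metric.ball 0 1), ‖A.symm x‖ = 1 := by
    intro x hx
    have : frontier (A '' Metric.ball 0 1) = A '' frontier (Metric.ball 0 1) :=
      ((AffineEquiv.toContinuousAffineEquiv A).toHomeomorph.image_frontier _).symm
    rw [this] at hx
    obtain ⟨y, hy, rfl⟩ := hx
    simpa using Metric.frontier_ball_subset_sphere hy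
  rw [hpre]
  exact hilbertArea_preimage_ball _ (A.symm.injective.comp ι.injective) hi
    (hfr _ h.left_mem) (hfr _ h.middle_mem) (hfr _ h.right_mem)

/-! ### Ideal triangles of plane domains and of the disc. -/

theorem map_openSegment {V W : Type*} [NormedAddCommGroup V] [NormedSpace ℝ V]
    [NormedAddCommGroup W] [NormedSpace ℝ W] (ψ : V →ᵃ[ℝ] W) (a b : V) {D : Set W}
    (h : openSegment ℝ a b ⊆ ψ ⁻¹' D) : openSegment ℝ (ψ a) (ψ b) ⊆ D := by
  rw [← image_openSegment]
  exact image_subset_iff.2 h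

theorem IsIdealTriangle.map {C : Set (EuclideanSpace ℝ (Fin n))}
    (ψ : Plane →ᵃ[ℝ] EuclideanSpace ℝ (Fin n)) (hψ : Function.Injective ψ) {a b c : Plane}
    (h : IsIdealTriangle (ψ ⁻¹' C) a b c) : IsIdealTriangle C (ψ a) (ψ b) (ψ c) where
  affineIndependent := (affineIndependent_map_triple ψ hψ).2 h.affineIndependent
  left_mem := ψ.continuous_of_finiteDimensional.frontier_preimage_subset _ h.left_mem
  middle_mem := ψ.continuous_of_finiteDimensional.frontier_preimage_subset _ h.middle_mem
  right_mem := ψ.continuous_of_finiteDimensional.frontier_preimage_subset _ h.right_mem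
  triangle_subset := by
    rw [← image_openTriangle]
    exact image_subset_iff.2 h.triangle_subset
  side_ab_subset := map_openSegment ψ _ _ h.side_ab_subset
  side_bc_subset := map_openSegment ψ _ _ h.side_bc_subset
  side_ca_subset := map_openSegment ψ _ _ h.side_ca_subset

theorem openSegment_subset_of_mem {D : Set Plane} (ho : IsOpen D) (hc : Convex ℝ D) {x y : Plane}
    (hx : x ∈ closure D) (hy : y ∈ D) : openSegment ℝ x y ⊆ D := by
  have := hc.openSegment_closure_interior_subset_interior hx (by rwa [ho.interior_eq])
  rwa [ho.interior_eq] at this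

theorem isIdealTriangle_of_sides {D : Set Plane} (ho : IsOpen D) (hD : Convex ℝ D) {a b c : Plane}
    (hi : AffineIndependent ℝ ![a, b, c]) (ha : a ∈ closure D \ D) (hb : b ∈ closure D \ D)
    (hc : c ∈ closure D \ D) (hab : openSegment ℝ a b ⊆ D) (hbc : openSegment ℝ b c ⊆ D)
    (hca : openSegment ℝ c a ⊆ D) : IsIdealTriangle D a b c where
  affineIndependent := hi
  left_mem := ho.frontier_eq ▸ ha
  middle_mem := ho.frontier_eq ▸ hb
  right_mem := ho.frontier_eq ▸ hc
  triangle_subset := by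
    rintro _ ⟨r, s, t, hr, hs, ht, h, rfl⟩
    have hst : 0 < s + t := by positivity
    have hmem : (s / (s + t)) • b + (t / (s + t)) • c ∈ D :=
      hbc ⟨_, _, by positivity, by positivity, by field_simp, rfl⟩
    refine openSegment_subset_of_mem ho hD ha.1 hmem ⟨r, s + t, hr, hst, by linarith, ?_⟩
    rw [smul_add, smul_smul, smul_smul, mul_div_cancel₀ _ hst.ne', mul_div_cancel₀ _ hst.ne',
      add_assoc]
  side_ab_subset := hab
  side_bc_subset := hbc
  side_ca_subset := hca

theorem affineIndependent_of_norm_eq_one {a b c : Plane} (ha : ‖a‖ = 1) (hb : ‖b‖ = 1)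
    (hc : ‖c‖ = 1) (hab : a ≠ b) (hbc : b ≠ c) (hca : c ≠ a) :
    AffineIndependent ℝ ![a, b, c] := by
  refine EuclideanGeometry.Cospherical.affineIndependent (s := Metric.sphere 0 1)
    ⟨0, 1, fun p hp => by simpa using hp⟩ ?_ ?_
  · rw [range_triple]
    rintro x (rfl | rfl | rfl) <;> simpa
  · intro i j hij
    fin_cases i <;> fin_cases j <;> simp_all [eq_comm]

theorem openSegment_subset_ball {a b : Plane} (ha : ‖a‖ = 1) (hb : ‖b‖ = 1) (hab : a ≠ b) :
    openSegment ℝ a b ⊆ Metric.ball 0 1 := by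
  have := (strictConvex_closedBall ℝ (0 : Plane) 1).openSegment_subset (x := a) (y := b)
    (by simp [ha]) (by simp [hb]) hab
  rwa [interior_closedBall _ one_ne_zero] at this

/-! ### Extremal inscribed and circumscribed ellipses. -/

/-- The affine map `x ↦ M x + m`. -/
def affineOf (M : Plane →ₗ[ℝ] Plane) (m : Plane) : Plane →ᵃ[ℝ] Plane where
  toFun x := M x + m
  linear := M
  map_vadd' x v := by simp only [vadd_eq_add, map_add]; abel

theorem affineOf_apply (M : Plane →ₗ[ℝ] Plane) (m x : Plane) : affineOf M m x = M x + m := rfl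

theorem affineOf_linear (M : Plane →ₗ[ℝ] Plane) (m : Plane) : (affineOf M m).linear = M := rfl

/-- Near a contact point the derivative of ‖x + t V x‖² at t = 0 is negative, so the point moves
into the open disc. Elsewhere openness of U suffices, and compactness of S makes t uniform. -/
theorem eventually_perturbation_mem {S U : Set Plane} (hS : IsCompact S)
    (hS1 : S ⊆ Metric.closedBall 0 1) (hU : IsOpen U) (hBU : Metric.ball 0 1 ⊆ U)
    {V : Plane → Plane} (hV : Continuous V) (hneg : ∀ x ∈ S \ U, inner ℝ x (V x) < 0) :
    ∀ᶠ t : ℝ in 𝓝[>] 0, ∀ x ∈ S, x + t • V x ∈ U := by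
  have key : ∀ᶠ t : ℝ in 𝓝 0, ∀ x ∈ S, 0 < t → ‖x‖ ≤ 1 → x + t • V x ∈ U := by
    refine hS.eventually_forall_of_forall_eventually fun x hx => ?_
    by_cases hxU : x ∈ U
    · have hc : Continuous fun z : ℝ × Plane => z.2 + z.1 • V z.2 := by fun_prop
      have := hc.continuousAt.eventually_mem (x := ((0 : ℝ), x)) (hU.mem_nhds (by simpa using hxU))
      exact this.mono fun z hz _ _ => hz
    · have hc : Continuous fun z : ℝ × Plane => 2 * inner ℝ z.2 (V z.2) + z.1 * ‖V z.2‖ ^ 2 := by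
        fun_prop
      have h0 : 2 * inner ℝ x (V x) + 0 * ‖V x‖ ^ 2 < 0 := by
        have := hneg x ⟨hx, hxU⟩; linarith
      have := (hc.continuousAt (x := ((0 : ℝ), x))).eventually_lt continuousAt_const h0
      refine this.mono fun z hz ht h1 => hBU ?_
      rw [mem_ball_zero_iff, ← sq_lt_one_iff₀ (norm_nonneg _), norm_add_sq_real, inner_smul_right,
        norm_smul, Real.norm_of_nonneg ht.le]
      have h2 : ‖z.2‖ ^ 2 ≤ 1 := pow_le_one₀ (norm_nonneg _) h1
      have h3 := mul_neg_of_pos_of_neg ht hz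
      nlinarith
  filter_upwards [nhdsWithin_le_nhds key, self_mem_nhdsWithin] with t ht h0 x hx
  exact ht x hx h0 (by simpa using hS1 hx)

/-- The eigenvalues are a - b‖u‖² along u and a on the orthogonal line. -/
theorem det_plane (a b : ℝ) (u : Plane) :
    LinearMap.det (a • LinearMap.id - b • ((innerₛₗ ℝ u).smulRight u) : Plane →ₗ[ℝ] Plane) =
      a ^ 2 - a * b * ‖u‖ ^ 2 := by
  rw [← LinearMap.det_toMatrix (EuclideanSpace.basisFun (Fin 2) ℝ).toBasis, Matrix.det_fin_two]
  simp [LinearMap.toMatrix_apply, EuclideanSpace.norm_sq_eq, EuclideanSpace.inner_single_right]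
  ring

/-- Two contact points cannot block an area-increasing perturbation. This one statement serves both
extremal problems, with S the disc or U the disc. -/
theorem exists_det_gt_one {S U : Set Plane} (hS : IsCompact S)
    (hS1 : S ⊆ Metric.closedBall 0 1) (hU : IsOpen U) (hBU : Metric.ball 0 1 ⊆ U)
    {u w : Plane} (hu : ‖u‖ = 1) (hw : ‖w‖ = 1) (hSU : S \ U ⊆ {u, w}) :
    ∃ g : Plane →ᵃ[ℝ] Plane, 1 < LinearMap.det g.linear ∧ ∀ x ∈ S, g x ∈ U := by
  have huu : inner ℝ u u = 1 := by rw [real_inner_self_eq_norm_sq, hu]; norm_num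
  have hww : inner ℝ w w = 1 := by rw [real_inner_self_eq_norm_sq, hw]; norm_num
  by_cases h : w = -u
  · subst h
    -- For antipodal contacts, shrink along u at rate 1 and stretch orthogonally at rate 2. The
    -- determinant is (1 - t)(1 + 2t), which exceeds 1 for small t > 0.
    have hev := eventually_perturbation_mem hS hS1 hU hBU
      (V := fun x => (2 : ℝ) • x - (3 * inner ℝ u x) • u) (by fun_prop) (by
        intro x hx
        rcases hSU hx with rfl | rfl <;> rw [inner_sub_right, inner_smul_right, inner_smul_right]
        · rw [huu]; norm_num
        · rw [hww, inner_neg_right, inner_neg_left, huu]; norm_num)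
    have hlt : ∀ᶠ t : ℝ in 𝓝[>] 0, t < 1 / 4 := nhdsWithin_le_nhds (Iio_mem_nhds (by norm_num))
    obtain ⟨t, ht, hlt, h0⟩ := (hev.and (hlt.and self_mem_nhdsWithin)).exists
    have h0 : 0 < t := h0
    refine ⟨affineOf ((1 + 2 * t) • LinearMap.id - (3 * t) • ((innerₛₗ ℝ u).smulRight u)) 0,
      ?_, fun x hx => ?_⟩
    · rw [affineOf_linear, det_plane, hu]
      nlinarith
    · convert ht x hx using 1
      simp only [affineOf_apply, LinearMap.sub_apply, LinearMap.smul_apply, LinearMap.id_apply,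
        LinearMap.smulRight_apply, innerₛₗ_apply_apply]
      module
  · have hpos : 0 < 1 + inner ℝ u w := by
      have h1 : 0 < ‖u + w‖ ^ 2 := by
        have : u + w ≠ 0 := fun e => h (eq_neg_of_add_eq_zero_right e)
        have := norm_pos_iff.2 this
        positivity
      rw [norm_add_sq_real, hu, hw] at h1
      linarith
    -- A dilation is combined with a translation away from u + w; this k makes ⟨x, V x⟩ = -1 at both
    -- contacts. The case u = w is included.
    set k := 2 / (1 + inner ℝ u w) with hk
    have hk1 : k * (1 + inner ℝ u w) = 2 := by rw [hk]; field_simp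
    have hev := eventually_perturbation_mem hS hS1 hU hBU
      (V := fun x => x - k • (u + w)) (by fun_prop) (by
        intro x hx
        rcases hSU hx with rfl | rfl <;> rw [inner_sub_right, inner_smul_right, inner_add_right]
        · rw [huu]; linarith
        · rw [hww, real_inner_comm]; linarith)
    obtain ⟨t, ht, h0⟩ := (hev.and self_mem_nhdsWithin).exists
    have h0 : 0 < t := h0
    refine ⟨affineOf ((1 + t) • LinearMap.id - (0 : ℝ) • ((innerₛₗ ℝ u).smulRight u))
      (-(t * k) • (u + w)), ?_, fun x hx => ?_⟩
    · rw [affineOf_linear, det_plane]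
      nlinarith
    · convert ht x hx using 1
      simp only [affineOf_apply, LinearMap.sub_apply, LinearMap.smul_apply, LinearMap.id_apply,
        LinearMap.smulRight_apply]
      module

theorem exists_subset_pair_or_triple {K : Set Plane} (hK : ∀ x ∈ K, ‖x‖ = 1) :
    (∃ u w : Plane, ‖u‖ = 1 ∧ ‖w‖ = 1 ∧ K ⊆ {u, w}) ∨
      ∃ a ∈ K, ∃ b ∈ K, ∃ c ∈ K, a ≠ b ∧ b ≠ c ∧ c ≠ a := by
  rcases K.eq_empty_or_nonempty with rfl | ⟨u, hu⟩
  · left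
    obtain ⟨e, he⟩ := exists_norm_eq (Plane) (zero_le_one (α := ℝ))
    exact ⟨e, e, he, he, empty_subset _⟩
  by_cases h1 : ∃ w ∈ K, w ≠ u
  · obtain ⟨w, hw, hwu⟩ := h1
    by_cases h2 : ∃ z ∈ K, z ≠ u ∧ z ≠ w
    · obtain ⟨z, hz, h3, h4⟩ := h2
      exact Or.inr ⟨u, hu, w, hw, z, hz, hwu.symm, h4.symm, h3⟩
    · push Not at h2
      refine Or.inl ⟨u, w, hK u hu, hK w hw, fun z hz => ?_⟩
      by_cases hzu : z = u
      · simp [hzu]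
      · simp [h2 z hz hzu]
  · push Not at h1
    exact Or.inl ⟨u, u, hK u hu, hK u hu, fun z hz => by simp [h1 z hz]⟩

/-- The affine maps sending S into T form a compact set: it is bounded because S contains a ball.
Since T contains a ball, a small homothety belongs to it, so the maximal |det| is nonzero and the
maximiser is invertible. -/
theorem exists_extremal_map {S T : Set Plane} (hS : IsCompact S) (hT : IsCompact T)
    (hSi : (interior S).Nonempty) (hTi : (interior T).Nonempty) :
    ∃ f : Plane ≃ᵃ[ℝ] Plane, (∀ x ∈ S, f x ∈ T) ∧ ∀ g : Plane →ᵃ[ℝ] Plane, (∀ x ∈ S, g x ∈ T) →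
      |LinearMap.det g.linear| ≤ |LinearMap.det (f : Plane →ᵃ[ℝ] Plane).linear| := by
  let K : Set ((Plane →L[ℝ] Plane) × Plane) := {p | ∀ x ∈ S, p.1 x + p.2 ∈ T}
  have hKc : IsClosed K := by
    have : K = ⋂ x ∈ S, (fun p : (Plane →L[ℝ] Plane) × Plane => p.1 x + p.2) ⁻¹' T := by
      ext p; simp [K]
    rw [this]
    refine isClosed_biInter fun x _ => hT.isClosed.preimage ?_
    exact ((ContinuousLinearMap.apply ℝ Plane x).continuous.comp continuous_fst).add continuous_snd
  obtain ⟨x₀, hx₀⟩ := hSi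
  obtain ⟨ρ, hρ, hρS⟩ := Metric.isOpen_iff.1 isOpen_interior x₀ hx₀
  obtain ⟨R, hR⟩ := hT.isBounded.subset_closedBall 0
  have hR' : ∀ y ∈ T, ‖y‖ ≤ R := fun y hy => by simpa using hR hy
  have hx₀S := interior_subset hx₀
  have hKb : Bornology.IsBounded K := by
    rw [isBounded_iff_forall_norm_le]
    have hR0 : ∀ p ∈ K, 0 ≤ R := fun p hp => (norm_nonneg _).trans (hR' _ (hp x₀ hx₀S))
    have h1 : ∀ p ∈ K, ‖p.1‖ ≤ 2 * R / (ρ / 2) := by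
      intro p hp
      have h0 := hR0 p hp
      refine p.1.opNorm_le_of_unit_norm (by positivity) fun v hv => ?_
      -- Comparing the images of x₀ and x₀ + (ρ/2) v, both in T, bounds the linear part.
      have h2 : x₀ + (ρ / 2) • v ∈ S := interior_subset (hρS (by
        rw [mem_ball_iff_norm, add_sub_cancel_left, norm_smul, hv, Real.norm_of_nonneg (by positivity)]
        linarith))
      have h3 := norm_sub_le_of_le (hR' _ (hp _ h2)) (hR' _ (hp x₀ hx₀S))
      have h4 : p.1 (x₀ + (ρ / 2) • v) + p.2 - (p.1 x₀ + p.2) = (ρ / 2) • p.1 v := by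
        rw [map_add, map_smul]; abel
      rw [h4, norm_smul, Real.norm_of_nonneg (by positivity)] at h3
      rw [le_div_iff₀ (by positivity)]
      linarith
    refine ⟨max (2 * R / (ρ / 2)) (R + 2 * R / (ρ / 2) * ‖x₀‖), fun p hp => ?_⟩
    refine max_le_max (h1 p hp) ?_
    have h2 : p.2 = (p.1 x₀ + p.2) - p.1 x₀ := by abel
    rw [h2]
    refine (norm_sub_le_of_le (hR' _ (hp x₀ hx₀S)) (p.1.le_opNorm x₀)).trans ?_
    gcongr
    exact h1 p hp
  have hcomp : IsCompact K := by
    have : ProperSpace ((Plane →L[ℝ] Plane) × Plane) := FiniteDimensional.proper ℝ _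
    exact Metric.isCompact_of_isClosed_isBounded hKc hKb
  obtain ⟨q, hq⟩ := hTi
  obtain ⟨δ, hδ, hδT⟩ := Metric.isOpen_iff.1 isOpen_interior q hq
  obtain ⟨R', hR'0, hR'S⟩ := hS.isBounded.subset_ball_lt 0 0
  have hs : ((δ / R') • ContinuousLinearMap.id ℝ Plane, q) ∈ K := by
    intro x hx
    have h1 : ‖x‖ < R' := by simpa using hR'S hx
    refine interior_subset (hδT ?_)
    rw [mem_ball_iff_norm, add_sub_cancel_right]
    simp only [smul_apply, ContinuousLinearMap.id_apply]
    rw [norm_smul, Real.norm_of_nonneg (by positivity), div_mul_eq_mul_div, div_lt_iff₀ hR'0]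
    gcongr
  obtain ⟨p, hp, hmax⟩ := hcomp.exists_isMaxOn ⟨_, hs⟩
    (f := fun p : (Plane →L[ℝ] Plane) × Plane => |p.1.det|)
    (ContinuousLinearMap.continuous_det.comp continuous_fst).abs.continuousOn
  have hmax' : ∀ g : Plane →ᵃ[ℝ] Plane, (∀ x ∈ S, g x ∈ T) →
      |LinearMap.det g.linear| ≤ |LinearMap.det (p.1 : Plane →ₗ[ℝ] Plane)| := by
    intro g hg
    refine hmax (a := (LinearMap.toContinuousLinearMap g.linear, g 0)) fun x hx => ?_
    have h1 := g.map_vadd 0 x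
    rw [vadd_eq_add, add_zero, vadd_eq_add] at h1
    have h2 := hg x hx
    rw [h1] at h2
    exact h2
  have hdet : LinearMap.det (p.1 : Plane →ₗ[ℝ] Plane) ≠ 0 := by
    have h1 := hmax hs
    have h2 : 0 < |((δ / R') • ContinuousLinearMap.id ℝ Plane).det| := by
      rw [ContinuousLinearMap.det]
      simp only [ContinuousLinearMap.toLinearMap_smul, ContinuousLinearMap.coe_id, LinearMap.det_smul, LinearMap.det_id]
      positivity
    exact abs_pos.1 (h2.trans_le h1)
  have hbij : Function.Bijective (affineOf (p.1 : Plane →ₗ[ℝ] Plane) p.2) :=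
    AffineMap.linear_bijective_iff _ |>.1 (LinearMap.equivOfDetNeZero _ hdet).bijective
  exact ⟨AffineEquiv.ofBijective hbij, hp, hmax'⟩

/-- Here f maximises |det| among affine maps of the closed disc into closure D. With at most two
contacts, composing with the map of `exists_det_gt_one` on the disc side contradicts maximality. -/
theorem exists_inscribed_position {D : Set Plane} (hD : IsConvexDomain D) :
    ∃ f : Plane ≃ᵃ[ℝ] Plane, Metric.ball 0 1 ⊆ f ⁻¹' D ∧ ∃ a b c : Plane, ‖a‖ = 1 ∧ ‖b‖ = 1 ∧
      ‖c‖ = 1 ∧ f a ∉ D ∧ f b ∉ D ∧ f c ∉ D ∧ a ≠ b ∧ b ≠ c ∧ c ≠ a := by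
  have hint : interior (closure D) = D := by
    rw [hD.convex.interior_closure_eq_interior_of_nonempty_interior
      (by rw [hD.isOpen.interior_eq]; exact hD.nonempty), hD.isOpen.interior_eq]
  obtain ⟨f, hf, hmax⟩ := exists_extremal_map (S := Metric.closedBall 0 1) (T := closure D)
    (isCompact_closedBall _ _) hD.isBounded.isCompact_closure
    (by rw [interior_closedBall _ one_ne_zero]; exact ⟨0, by simp⟩)
    (by rw [hint]; exact hD.nonempty)
  have hfc : Continuous f := AffineEquiv.continuous_of_finiteDimensional _
  have hball : Metric.ball 0 1 ⊆ f ⁻¹' D := by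
    have hfo : IsOpenMap f := (AffineEquiv.toContinuousAffineEquiv f).toHomeomorph.isOpenMap
    rw [← image_subset_iff]
    refine (interior_maximal ?_ (hfo _ Metric.isOpen_ball)).trans hint.le
    rintro _ ⟨x, hx, rfl⟩
    exact hf x (Metric.ball_subset_closedBall hx)
  have hK : ∀ x ∈ Metric.closedBall 0 1 \ f ⁻¹' D, ‖x‖ = 1 := by
    rintro x ⟨h1, h2⟩
    refine le_antisymm (by simpa using h1) (not_lt.1 fun h => h2 (hball (by simpa using h)))
  rcases exists_subset_pair_or_triple hK with ⟨u, w, hu, hw, hsub⟩ | ⟨a, ha, b, hb, c, hc, h⟩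
  · obtain ⟨g, hg1, hg⟩ := exists_det_gt_one (isCompact_closedBall _ _) Subset.rfl
      (hD.isOpen.preimage hfc) hball hu hw hsub
    have h1 := hmax ((f : Plane →ᵃ[ℝ] Plane).comp g) fun x hx => subset_closure (hg x hx)
    have h2 : LinearMap.det (f : Plane →ᵃ[ℝ] Plane).linear ≠ 0 := f.linear.isUnit_det'.ne_zero
    have h3 := abs_pos.2 h2
    have h4 : ((f : Plane →ᵃ[ℝ] Plane).comp g).linear =
      (f : Plane →ᵃ[ℝ] Plane).linear ∘ₗ g.linear := rfl
    rw [h4, LinearMap.det_comp, abs_mul, abs_of_pos (zero_lt_one.trans hg1)] at h1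
    nlinarith
  · exact ⟨f, hball, a, b, c, hK a ha, hK b hb, hK c hc, ha.2, hb.2, hc.2, h⟩

/-- The smallest circumscribed ellipse comes from the dual problem: maximise |det| among affine maps
of closure D into the closed disc, then invert. The perturbation is now composed on the target side.
-/
theorem exists_circumscribed_position {D : Set Plane} (hD : IsConvexDomain D) :
    ∃ f : Plane ≃ᵃ[ℝ] Plane, f ⁻¹' D ⊆ Metric.ball 0 1 ∧ ∃ a b c : Plane, ‖a‖ = 1 ∧ ‖b‖ = 1 ∧
      ‖c‖ = 1 ∧ f a ∈ closure D ∧ f b ∈ closure D ∧ f c ∈ closure D ∧ a ≠ b ∧ b ≠ c ∧ c ≠ a := by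
  have hint : interior (closure D) = D := by
    rw [hD.convex.interior_closure_eq_interior_of_nonempty_interior
      (by rw [hD.isOpen.interior_eq]; exact hD.nonempty), hD.isOpen.interior_eq]
  obtain ⟨f, hf, hmax⟩ := exists_extremal_map (S := closure D) (T := Metric.closedBall 0 1)
    hD.isBounded.isCompact_closure (isCompact_closedBall _ _) (by rw [hint]; exact hD.nonempty)
    (by rw [interior_closedBall _ one_ne_zero]; exact ⟨0, by simp⟩)
  have hfc : Continuous f.symm := AffineEquiv.continuous_of_finiteDimensional _
  have hfc' : Continuous f := AffineEquiv.continuous_of_finiteDimensional _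
  have hball : f.symm ⁻¹' D ⊆ Metric.ball 0 1 := by
    rw [← interior_closedBall _ one_ne_zero]
    refine interior_maximal ?_ (hD.isOpen.preimage hfc)
    intro x hx
    simpa using hf _ (subset_closure hx)
  have hS : f.symm ⁻¹' closure D = f '' closure D := by
    ext x
    constructor
    · intro hx
      exact ⟨f.symm x, hx, by simp⟩
    · rintro ⟨y, hy, rfl⟩
      simpa using hy
  have hScomp : IsCompact (f.symm ⁻¹' closure D) := by
    rw [hS]
    exact hD.isBounded.isCompact_closure.image hfc'
  have hS1 : f.symm ⁻¹' closure D ⊆ Metric.closedBall 0 1 := by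
    rw [hS]
    rintro _ ⟨y, hy, rfl⟩
    exact hf y hy
  have hK : ∀ x ∈ f.symm ⁻¹' closure D \ Metric.ball 0 1, ‖x‖ = 1 := by
    rintro x ⟨h1, h2⟩
    exact le_antisymm (by simpa using hS1 h1) (by simpa using h2)
  rcases exists_subset_pair_or_triple hK with ⟨u, w, hu, hw, hsub⟩ | ⟨a, ha, b, hb, c, hc, h⟩
  · obtain ⟨g, hg1, hg⟩ := exists_det_gt_one hScomp hS1 Metric.isOpen_ball Subset.rfl hu hw hsub
    have h1 := hmax (g.comp (f : Plane →ᵃ[ℝ] Plane)) fun x hx =>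
      Metric.ball_subset_closedBall (hg (f x) (by simpa using hx))
    have h2 : LinearMap.det (f : Plane →ᵃ[ℝ] Plane).linear ≠ 0 := f.linear.isUnit_det'.ne_zero
    have h3 := abs_pos.2 h2
    have h4 : (g.comp (f : Plane →ᵃ[ℝ] Plane)).linear =
      g.linear ∘ₗ (f : Plane →ᵃ[ℝ] Plane).linear := rfl
    rw [h4, LinearMap.det_comp, abs_mul, abs_of_pos (zero_lt_one.trans hg1)] at h1
    nlinarith
  · exact ⟨f.symm, hball, a, b, c, hK a ha, hK b hb, hK c hc, ha.1, hb.1, hc.1, h⟩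

/-! ### Supporting lines and corners. -/

/-- A functional separating D from a point of the open segment is maximal there over closure D;
being affine along the segment, it takes the same value at both ends. -/
theorem exists_supporting_functional {D : Set Plane} (ho : IsOpen D) (hc : Convex ℝ D)
    {x y : Plane} (hx : x ∈ closure D) (hy : y ∈ closure D) (h : ¬ openSegment ℝ x y ⊆ D) :
    ∃ f : StrongDual ℝ Plane, (∀ p ∈ D, f p < f x) ∧ f y = f x := by
  obtain ⟨w, hw, hwD⟩ := not_subset.1 h
  obtain ⟨f, hf⟩ := geometric_hahn_banach_open_point hc ho hwD
  have hcl : ∀ p ∈ closure D, f p ≤ f w := fun p hp =>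
    closure_minimal (fun z hz => (hf z hz).le) (isClosed_le f.continuous continuous_const) hp
  have h1 := hcl x hx
  have h2 := hcl y hy
  obtain ⟨r, s, hr, hs, hrs, rfl⟩ := hw
  have e : f (r • x + s • y) = r * f x + s * f y := by simp
  rw [e] at h1 h2 hf
  obtain rfl : r = 1 - s := by linarith
  have h3 : f x ≤ f y := le_of_mul_le_mul_left (by linarith) hs
  have h4 : f y ≤ f x := le_of_mul_le_mul_left (by linarith) hr
  have h5 : f y = f x := le_antisymm h4 h3
  refine ⟨f, fun p hp => (hf p hp).trans_eq ?_, h5⟩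
  rw [h5]; ring

theorem exists_exit {D : Set Plane} (hD : IsConvexDomain D) {q d : Plane} (hq : q ∈ D)
    (hd : d ≠ 0) : ∃ e : ℝ, 0 < e ∧ q + e • d ∈ closure D \ D := by
  have hs := exitRate_pos hD.isOpen hD.isBounded hq hd
  have h1 : exitRate D q ((exitRate D q d)⁻¹ • d) = 1 := by
    rw [exitRate_smul _ _ _ (inv_pos.2 hs).le, inv_mul_cancel₀ hs.ne']
  refine ⟨_, inv_pos.2 hs, ?_, ?_⟩
  · have := (gauge_le_one_iff_mem_closure (convex_shift hD.convex)
      (shift_mem_nhds hD.isOpen hq)).1 h1.le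
    have hc : Continuous fun w : Plane => q + w := by fun_prop
    exact hc.closure_preimage_subset D this
  · rw [← exitRate_lt_one_iff hD.isOpen hD.convex hq, h1]
    exact lt_irrefl _

/-- If v has norm less than 1, then q ± v/2 lie in D, so each linear form λ positive on D satisfies
|λ v| < 2 λ q. Two forms confine v to a parallelogram, whose area is the bound. -/
theorem measure_hilbertBall_le_of_wedge {D : Set (ℝ × ℝ)} (ho : IsOpen D) (hc : Convex ℝ D)
    {m₁ m₂ : ℝ} (hm : m₁ ≠ m₂) (h1 : ∀ q ∈ D, 0 < q.1 + q.2)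
    (h2 : ∀ q ∈ D, 0 < m₁ * q.1 + m₂ * q.2) {q : ℝ × ℝ} (hq : q ∈ D) :
    volume {v | hilbertNorm D q v < 1} ≤
      ENNReal.ofReal (16 / |m₂ - m₁| * ((q.1 + q.2) * (m₁ * q.1 + m₂ * q.2))) := by
  let L := Matrix.toLin (Basis.finTwoProd ℝ) (Basis.finTwoProd ℝ) !![1, 1; m₁, m₂]
  have hL : LinearMap.det L = m₂ - m₁ := by
    rw [det_finTwoProd]
    ring
  have hne : m₂ - m₁ ≠ 0 := sub_ne_zero.2 hm.symm
  have key : ∀ α β : ℝ, (∀ q ∈ D, 0 < α * q.1 + β * q.2) → ∀ v : ℝ × ℝ, hilbertNorm D q v < 1 →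
      α * v.1 + β * v.2 < 2 * (α * q.1 + β * q.2) := by
    intro α β hαβ v hv
    have h0 := exitRate_nonneg D q v
    have hlt : exitRate D q (-v) < 2 := by unfold hilbertNorm at hv; linarith
    have := hαβ _ ((exitRate_lt_iff ho hc hq (-v) two_pos).1 hlt)
    simp only [Prod.fst_add, Prod.snd_add, Prod.smul_fst, Prod.smul_snd, Prod.fst_neg,
      Prod.snd_neg, smul_eq_mul] at this
    linarith
  set s := q.1 + q.2
  set t := m₁ * q.1 + m₂ * q.2
  have hs : 0 < s := h1 q hq
  have ht : 0 < t := h2 q hq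
  have hsub : {v | hilbertNorm D q v < 1} ⊆
      L ⁻¹' (Ioo (-(2 * s)) (2 * s) ×ˢ Ioo (-(2 * t)) (2 * t)) := by
    intro v hv
    have hv' : hilbertNorm D q (-v) < 1 := by rwa [hilbertNorm_neg]
    have a1 := key 1 1 (by simpa using h1) v hv
    have a2 := key 1 1 (by simpa using h1) (-v) hv'
    have b1 := key m₁ m₂ h2 v hv
    have b2 := key m₁ m₂ h2 (-v) hv'
    simp only [Prod.fst_neg, Prod.snd_neg, one_mul] at a1 a2 b1 b2
    simp only [L, mem_preimage, Matrix.toLin_finTwoProd_apply, mem_prod, mem_Ioo, one_mul]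
    refine ⟨⟨?_, ?_⟩, ?_, ?_⟩ <;> linarith
  refine (measure_mono hsub).trans_eq ?_
  rw [Measure.addHaar_preimage_linearMap _ (by rwa [hL]), hL, Measure.volume_eq_prod,
    Measure.prod_prod, Real.volume_Ioo, Real.volume_Ioo, ← ENNReal.ofReal_mul (by linarith),
    ← ENNReal.ofReal_mul (by positivity), abs_inv]
  congr 1
  field_simp
  ring

/-- The integrand is homogeneous of degree -2, so the triangle and its half-size copy at the origin
have equal integrals. Were they finite, the positive integrand would have zero integral over the
difference, which has positive measure. Where the product is not positive the integrand is ⊤, so no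
sign condition is needed. -/
theorem lintegral_wedge_eq_top (κ m₁ m₂ : ℝ) :
    ∫⁻ q in stdTriangle, ENNReal.ofReal Real.pi /
      ENNReal.ofReal (κ * ((q.1 + q.2) * (m₁ * q.1 + m₂ * q.2))) = ⊤ := by
  set h : ℝ × ℝ → ENNReal := fun q => ENNReal.ofReal Real.pi /
      ENNReal.ofReal (κ * ((q.1 + q.2) * (m₁ * q.1 + m₂ * q.2))) with hh
  have hmeas : Measurable h := by fun_prop
  have hpos : ∀ q, h q ≠ 0 := fun q => by
    rw [hh]
    simpa [ENNReal.div_eq_zero_iff] using Real.pi_pos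
  set T' : Set (ℝ × ℝ) := (fun q : ℝ × ℝ => (2 : ℝ) • q) ⁻¹' stdTriangle with hT'
  have hT'o : IsOpen T' := isOpen_stdTriangle.preimage (by fun_prop)
  have hscale : ∀ q, h ((2 : ℝ) • q) = 4⁻¹ * h q := by
    intro q
    have e : κ * ((((2 : ℝ) • q).1 + ((2 : ℝ) • q).2) * (m₁ * ((2 : ℝ) • q).1 +
        m₂ * ((2 : ℝ) • q).2)) = 4 * (κ * ((q.1 + q.2) * (m₁ * q.1 + m₂ * q.2))) := by
      simp only [Prod.smul_fst, Prod.smul_snd, smul_eq_mul]; ring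
    simp only [hh, e]
    rw [ENNReal.ofReal_mul (by norm_num), div_eq_mul_inv, ENNReal.mul_inv (by simp) (by simp),
      div_eq_mul_inv]
    rw [show ENNReal.ofReal 4 = 4 by simp]
    ring
  have h1 : ∫⁻ q in T', h q = ∫⁻ q in stdTriangle, h q := by
    have hmap := Measure.map_addHaar_smul (volume : Measure (ℝ × ℝ)) (r := 2) two_ne_zero
    have h2 := setLIntegral_map (μ := (volume : Measure (ℝ × ℝ)))
      (g := fun q : ℝ × ℝ => (2 : ℝ) • q) isOpen_stdTriangle.measurableSet hmeas
      (by fun_prop)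
    rw [hmap] at h2
    simp only [hscale] at h2
    rw [lintegral_const_mul _ hmeas, Measure.restrict_smul, lintegral_smul_measure] at h2
    have e : ENNReal.ofReal |((2 : ℝ) ^ finrank ℝ (ℝ × ℝ))⁻¹| = 4⁻¹ := by
      rw [Module.finrank_prod, Module.finrank_self, abs_of_pos (by positivity),
        ENNReal.ofReal_inv_of_pos (by positivity)]
      norm_num
    rw [e, smul_eq_mul] at h2
    exact ((ENNReal.mul_right_inj (by simp) (by simp)).1 h2).symm
  by_contra hfin
  have hsub : T' ⊆ stdTriangle := by
    rintro q ⟨a, b, c⟩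
    simp only [Prod.smul_fst, Prod.smul_snd, smul_eq_mul] at a b c
    exact ⟨by linarith, by linarith, by linarith⟩
  have h3 := lintegral_inter_add_sdiff h stdTriangle hT'o.measurableSet (μ := volume)
  rw [inter_eq_right.2 hsub, h1] at h3
  have h4 : ∫⁻ q in stdTriangle \ T', h q = 0 := by
    have := (ENNReal.add_right_inj hfin).1 (h3.trans (add_zero _).symm)
    exact this
  rw [lintegral_eq_zero_iff hmeas] at h4
  have h5 : volume (stdTriangle \ T') = 0 := by
    rw [← Measure.restrict_eq_zero, ← ae_eq_bot, ← eventually_false_iff_eq_bot]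
    exact h4.mono fun q hq => hpos q hq
  set U : Set (ℝ × ℝ) := stdTriangle ∩ {q | 1 / 2 < q.1 + q.2}
  have hU : IsOpen U := isOpen_stdTriangle.inter
    (isOpen_lt continuous_const (continuous_fst.add continuous_snd))
  have hUn : U.Nonempty := ⟨(1 / 3, 1 / 3), by
    constructor
    · refine ⟨?_, ?_, ?_⟩ <;> norm_num
    · simp only [mem_ofPred_eq]; norm_num⟩
  refine (hU.measure_pos volume hUn).ne' (measure_mono_null ?_ h5)
  rintro q ⟨hq1, hq2⟩
  refine ⟨hq1, ?_⟩
  rintro ⟨-, -, c⟩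
  simp only [Prod.smul_fst, Prod.smul_snd, smul_eq_mul] at c
  simp only [mem_ofPred_eq] at hq2
  linarith

/-- The ideal triangles of a domain with a corner at the end of a flat side have unbounded
areas. -/
theorem exists_large_ideal_triangle {D : Set Plane} (hD : IsConvexDomain D) {a b : Plane}
    (ha : a ∈ closure D) (hb : b ∈ closure D) {f g : StrongDual ℝ Plane}
    (hf : ∀ x ∈ D, f x < f a) (hfb : f b = f a) (hg : ∀ x ∈ D, g x < g a) (hgb : g b < g a)
    {K : ENNReal} (hK : K ≠ ⊤) :
    ∃ x y z, IsIdealTriangle D x y z ∧ K < hilbertArea volume D (openTriangle x y z) := by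
  have ho := hD.isOpen
  have hc := hD.convex
  obtain ⟨q, hq⟩ := hD.nonempty
  set d := b - a with hd
  have hfd : f d = 0 := by rw [hd, map_sub, hfb, sub_self]
  have hgd : g d < 0 := by rw [hd, map_sub]; linarith
  have hd0 : d ≠ 0 := by rintro e; rw [e, map_zero] at hgd; exact lt_irrefl _ hgd
  obtain ⟨e₁, he₁, hy⟩ := exists_exit hD hq hd0
  obtain ⟨e₂, he₂, hz⟩ := exists_exit hD hq (neg_ne_zero.2 hd0)
  set y := q + e₁ • d with hy'
  set z := q + e₂ • -d with hz'
  have hyz : y - z = (e₁ + e₂) • d := by rw [hy', hz']; module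
  have hfy : f y = f q := by simp [hy', hfd]
  have hfz : f z = f q := by simp [hz', hfd]
  have hfq := hf q hq
  -- A line supporting D along this chord would contain the interior point q.
  have hyzD : openSegment ℝ y z ⊆ D := by
    by_contra hcon
    obtain ⟨k, hk1, hk2⟩ := exists_supporting_functional ho hc hy.1 hz.1 hcon
    have h1 : k (y - z) = 0 := by rw [map_sub, hk2, sub_self]
    rw [hyz, map_smul, smul_eq_mul, mul_eq_zero] at h1
    have h2 : k d = 0 := h1.resolve_left (by positivity)
    have h3 := hk1 q hq
    simp [hy', h2] at h3
  -- Strict inequalities on τ matter: a functional maximal at an interior point of [a, b] is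
  -- constant along d, so it would also be maximal at q. At a itself this may fail, which is why the
  -- vertex is moved off the corner.
  have hflat : ∀ τ : ℝ, 0 < τ → τ < 1 → ∀ p ∈ closure D, (∃ e : ℝ, p = q + e • d) →
      openSegment ℝ (a + τ • d) p ⊆ D := by
    rintro τ h0 h1 p hp ⟨e, hpe⟩
    by_contra hcon
    have hx : a + τ • d ∈ closure D :=
      hc.closure ha hb (by linarith : 0 ≤ 1 - τ) h0.le (by ring) |> fun h => by
        convert h using 1
        rw [hd]; module
    obtain ⟨k, hk1, hk2⟩ := exists_supporting_functional ho hc hx hp hcon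
    have hcl : ∀ w ∈ closure D, k w ≤ k (a + τ • d) := fun w hw =>
      closure_minimal (fun z hz => (hk1 z hz).le) (isClosed_le k.continuous continuous_const) hw
    have h2 := hcl a ha
    have h3 := hcl b hb
    have h4 : b = a + d := by rw [hd]; abel
    rw [h4] at h3
    have h5 := hk1 q hq
    rw [hpe] at hk2
    simp only [map_add, map_smul, smul_eq_mul] at h2 h3 h5 hk2
    have h6 : 0 ≤ k d := by
      by_contra h; push Not at h; nlinarith
    have h7 : k d ≤ 0 := by nlinarith
    have h8 : k d = 0 := le_antisymm h7 h6
    rw [h8] at hk2 h5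
    linarith
  have hxD : ∀ τ : ℝ, 0 < τ → τ < 1 → a + τ • d ∈ closure D \ D := by
    intro τ h0 h1
    constructor
    · have h := hc.closure ha hb (by linarith : 0 ≤ 1 - τ) h0.le (by ring)
      convert h using 1
      rw [hd]; module
    · intro hcon
      have := hf _ hcon
      simp [hfd] at this
  have hindep : ∀ x, f x = f a → AffineIndependent ℝ ![x, y, z] := by
    intro x hx
    rw [linearIndependent_of_triple, LinearIndependent.pair_iff]
    intro s t hst
    have h1 := congrArg f hst
    simp only [map_add, map_smul, map_sub, hfy, hfz, hx, smul_eq_mul, map_zero] at h1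
    have h2 : (s + t) * (f q - f a) = 0 := by linarith
    have h3 : s + t = 0 := (mul_eq_zero.1 h2).resolve_right (by linarith)
    obtain rfl : t = -s := by linarith
    have h4 : (s * (e₁ + e₂)) • d = 0 := by
      rw [mul_smul, ← hyz, ← hst]; module
    have h5 := (smul_eq_zero.1 h4).resolve_right hd0
    have h6 : s = 0 := (mul_eq_zero.1 h5).resolve_right (by positivity)
    simp [h6]
  have hideal : ∀ τ : ℝ, 0 < τ → τ < 1 → IsIdealTriangle D (a + τ • d) y z := by
    intro τ h0 h1
    refine isIdealTriangle_of_sides ho hc (hindep _ (by simp [hfd])) (hxD τ h0 h1) hy hz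
      (hflat τ h0 h1 y hy.1 ⟨e₁, rfl⟩) hyzD ?_
    rw [openSegment_symm]
    exact hflat τ h0 h1 z hz.1 ⟨-e₂, by rw [hz']; module⟩
  have hi := hindep a rfl
  set ψ := chartEquiv hi with hψ
  set m₁ := g a - g y with hm₁
  set m₂ := g a - g z with hm₂
  have hm : m₁ ≠ m₂ := by
    intro h
    have h1 : g (y - z) = 0 := by rw [map_sub]; linarith
    rw [hyz, map_smul, smul_eq_mul, mul_eq_zero] at h1
    rcases h1 with h1 | h1
    · linarith
    · linarith
  have hψo : IsOpen (ψ ⁻¹' D) := ho.preimage (AffineEquiv.continuous_of_finiteDimensional _)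
  have hψc : Convex ℝ (ψ ⁻¹' D) := hc.affine_preimage (ψ : ℝ × ℝ →ᵃ[ℝ] Plane)
  have hw1 : ∀ p ∈ ψ ⁻¹' D, 0 < p.1 + p.2 := by
    intro p hp
    have h1 := hf _ hp
    rw [hψ, chartEquiv_apply] at h1
    simp only [map_add, map_smul, map_sub, hfy, hfz, smul_eq_mul] at h1
    have h2 : 0 < (p.1 + p.2) * (f a - f q) := by linarith
    exact pos_of_mul_pos_left h2 (by linarith)
  have hw2 : ∀ p ∈ ψ ⁻¹' D, 0 < m₁ * p.1 + m₂ * p.2 := by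
    intro p hp
    have h1 := hg _ hp
    rw [hψ, chartEquiv_apply] at h1
    simp only [map_add, map_smul, map_sub, smul_eq_mul] at h1
    rw [hm₁, hm₂]
    linarith
  set κ := 16 / |m₂ - m₁|
  set h : ℝ × ℝ → ENNReal := fun q => ENNReal.ofReal Real.pi /
      ENNReal.ofReal (κ * ((q.1 + q.2) * (m₁ * q.1 + m₂ * q.2))) with hh
  have hE : 0 < e₁ + e₂ := by positivity
  set ε : ℕ → ℝ := fun k => 1 / ((k : ℝ) + 2) with hε
  have hε0 : ∀ k, 0 < ε k := fun k => by positivity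
  have hε1 : ∀ k, ε k < 1 := fun k => by
    rw [hε, div_lt_one (by positivity)]
    have : (0 : ℝ) ≤ k := k.cast_nonneg
    linarith
  -- In the chart of the limit triangle a y z, this is the part covered by the ideal triangle with
  -- vertex a + ε d. These sets increase to the whole triangle, where the wedge integral is
  -- infinite.
  set T : ℕ → Set (ℝ × ℝ) := fun k =>
    stdTriangle ∩ {p | (1 - p.1 - p.2) * (ε k / (e₁ + e₂)) < p.1} with hT
  have hTmeas : ∀ k, MeasurableSet (T k) := fun k =>
    (isOpen_stdTriangle.inter (isOpen_lt (by fun_prop) (by fun_prop))).measurableSet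
  have hTmono : Monotone T := by
    intro i j hij p hp
    refine ⟨hp.1, ?_⟩
    have hp2 : (1 - p.1 - p.2) * (ε i / (e₁ + e₂)) < p.1 := hp.2
    change (1 - p.1 - p.2) * (ε j / (e₁ + e₂)) < p.1
    refine lt_of_le_of_lt ?_ hp2
    have h3 := hp.1.2.2
    have hε' : ε j ≤ ε i := by
      simp only [hε]
      gcongr
    have : 0 ≤ 1 - p.1 - p.2 := by linarith
    gcongr
  have hTU : ⋃ k, T k = stdTriangle := by
    refine subset_antisymm (iUnion_subset fun k => inter_subset_left) fun p hp => ?_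
    have hlim : Tendsto ε atTop (𝓝 0) := by
      have := (tendsto_one_div_add_atTop_nhds_zero_nat (𝕜 := ℝ)).comp (tendsto_add_atTop_nat 1)
      refine this.congr fun k => ?_
      simp only [hε, Function.comp, Nat.cast_add, Nat.cast_one]
      ring
    have h2 : Tendsto (fun k => (1 - p.1 - p.2) * (ε k / (e₁ + e₂))) atTop (𝓝 0) := by
      simpa using (hlim.div_const (e₁ + e₂)).const_mul (1 - p.1 - p.2)
    obtain ⟨k, hk⟩ := (h2.eventually_lt_const hp.1).exists
    exact mem_iUnion.2 ⟨k, hp, hk⟩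
  have hsup : ⨆ k, ∫⁻ p in T k, h p = ⊤ := by
    have h1 := hTmono.measure_iUnion (μ := (volume : Measure (ℝ × ℝ)).withDensity h)
    rw [hTU, withDensity_apply _ isOpen_stdTriangle.measurableSet, lintegral_wedge_eq_top] at h1
    rw [h1]
    exact iSup_congr fun k => (withDensity_apply _ (hTmeas k)).symm
  obtain ⟨k, hk⟩ := lt_iSup_iff.1 (hsup ▸ lt_top_iff_ne_top.2 hK)
  have hIk := hideal (ε k) (hε0 k) (hε1 k)
  refine ⟨_, y, z, hIk, hk.trans_le ?_⟩
  rw [← hilbertArea_preimage volume volume ψ]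
  have hTk : T k ⊆ ψ ⁻¹' openTriangle (a + ε k • d) y z := by
    rintro p ⟨⟨p1, p2, p3⟩, p4⟩
    simp only [mem_ofPred_eq] at p4
    -- As d = (y - z) / (e₁ + e₂), replacing a by a + ε d in barycentric coordinates transfers the
    -- weight η from y to z.
    set η := (1 - p.1 - p.2) * (ε k / (e₁ + e₂)) with hη
    have hη0 : 0 < η := mul_pos (by linarith) (div_pos (hε0 k) hE)
    refine ⟨1 - p.1 - p.2, p.1 - η, p.2 + η, by linarith, by linarith, by linarith, by ring, ?_⟩
    have h5 : y = z + (e₁ + e₂) • d := by rw [← hyz]; abel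
    have h6 : η * (e₁ + e₂) = (1 - p.1 - p.2) * ε k := by rw [hη]; field_simp
    have h7 : ψ p = (1 - p.1 - p.2) • (a + ε k • d) + (p.1 - η) • y + (p.2 + η) • z +
        (η • (y - z) - ((1 - p.1 - p.2) * ε k) • d) := by
      rw [hψ, chartEquiv_apply]; module
    rw [h7, hyz, smul_smul, h6, sub_self, add_zero]
  refine le_trans ?_ (lintegral_mono_set hTk)
  refine setLIntegral_mono' (hTmeas k) fun p hp => ?_
  have hpD : p ∈ ψ ⁻¹' D := hIk.triangle_subset (hTk hp)
  exact ENNReal.div_le_div_left (measure_hilbertBall_le_of_wedge hψo hψc hm hw1 hw2 hpD) _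

/-! ### Comparison of a plane domain with its extremal ellipses. -/

theorem isConvexDomain_preimage {D : Set (EuclideanSpace ℝ (Fin n))} (hD : IsConvexDomain D)
    (f : EuclideanSpace ℝ (Fin n) ≃ᵃ[ℝ] EuclideanSpace ℝ (Fin n)) : IsConvexDomain (f ⁻¹' D) where
  nonempty := hD.nonempty.preimage f.surjective
  isOpen := hD.isOpen.preimage (AffineEquiv.continuous_of_finiteDimensional _)
  convex := hD.convex.affine_preimage (f : EuclideanSpace ℝ (Fin n) →ᵃ[ℝ] EuclideanSpace ℝ (Fin n))
  isBounded := by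
    have hc : Continuous f.symm := AffineEquiv.continuous_of_finiteDimensional _
    refine (hD.isBounded.isCompact_closure.image hc).isBounded.subset fun x hx => ?_
    exact ⟨f x, subset_closure hx, by simp⟩

theorem isEllipsoid_of_preimage_eq_ball {D : Set (EuclideanSpace ℝ (Fin n))}
    (f : EuclideanSpace ℝ (Fin n) ≃ᵃ[ℝ] EuclideanSpace ℝ (Fin n))
    (h : f ⁻¹' D = Metric.ball 0 1) : IsEllipsoid D :=
  ⟨f, by rw [← h, image_preimage_eq _ f.surjective]⟩

theorem hilbertArea_map (D : Set Plane) (f : Plane ≃ᵃ[ℝ] Plane) (a b c : Plane) :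
    hilbertArea volume D (openTriangle (f a) (f b) (f c)) =
      hilbertArea volume (f ⁻¹' D) (openTriangle a b c) := by
  have h : openTriangle (f a) (f b) (f c) = f '' openTriangle a b c :=
    (image_openTriangle (f : Plane →ᵃ[ℝ] Plane) a b c).symm
  rw [← hilbertArea_preimage volume volume f, h, preimage_image_eq _ f.injective]

theorem hilbertArea_ball {a b c : Plane} (h : AffineIndependent ℝ ![a, b, c]) (ha : ‖a‖ = 1)
    (hb : ‖b‖ = 1) (hc : ‖c‖ = 1) :
    hilbertArea volume (Metric.ball 0 1) (openTriangle a b c) = ENNReal.ofReal Real.pi :=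
  hilbertArea_preimage_ball (AffineMap.id ℝ Plane) Function.injective_id h ha hb hc

theorem exists_ideal_triangle_lt_pi {D : Set Plane} (hD : IsConvexDomain D)
    (hE : ¬ IsEllipsoid D) : ∃ a b c, IsIdealTriangle D a b c ∧
      hilbertArea volume D (openTriangle a b c) < ENNReal.ofReal Real.pi := by
  obtain ⟨f, hf, a, b, c, ha, hb, hc, haD, hbD, hcD, hab, hbc, hca⟩ := exists_inscribed_position hD
  have hD' := isConvexDomain_preimage hD f
  have hi := affineIndependent_of_norm_eq_one ha hb hc hab hbc hca
  have hcl : ∀ x : Plane, ‖x‖ = 1 → x ∈ closure (f ⁻¹' D) := fun x hx =>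
    closure_mono hf (by rw [closure_ball _ one_ne_zero]; simp [hx])
  have hideal : IsIdealTriangle (f ⁻¹' D) a b c :=
    isIdealTriangle_of_sides hD'.isOpen hD'.convex hi ⟨hcl a ha, haD⟩ ⟨hcl b hb, hbD⟩
      ⟨hcl c hc, hcD⟩ ((openSegment_subset_ball ha hb hab).trans hf)
      ((openSegment_subset_ball hb hc hbc).trans hf) ((openSegment_subset_ball hc ha hca).trans hf)
  refine ⟨f a, f b, f c, hideal.map (f : Plane →ᵃ[ℝ] Plane) f.injective, ?_⟩
  have hss : Metric.ball 0 1 ⊂ f ⁻¹' D :=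
    hf.ssubset_of_ne fun h => hE (isEllipsoid_of_preimage_eq_ball f h.symm)
  have hfr : ∀ x : Plane, ‖x‖ = 1 → x ∈ closure (Metric.ball 0 1) \ Metric.ball 0 1 := fun x hx =>
    ⟨by rw [closure_ball _ one_ne_zero]; simp [hx], by simp [hx]⟩
  have hballT := (isIdealTriangle_of_sides Metric.isOpen_ball (convex_ball 0 1) hi (hfr a ha)
    (hfr b hb) (hfr c hc) (openSegment_subset_ball ha hb hab) (openSegment_subset_ball hb hc hbc)
    (openSegment_subset_ball hc ha hca)).triangle_subset
  rw [hilbertArea_map, ← hilbertArea_ball hi ha hb hc]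
  refine hilbertArea_lt_of_ssubset Metric.isOpen_ball (convex_ball 0 1) Metric.isBounded_ball
    hD'.isOpen hD'.convex hss (isOpen_openTriangle hi) (openTriangle_nonempty _ _ _) hballT ?_
  -- Finiteness comes from weak monotonicity: the area in the larger domain is at most π.
  refine ne_top_of_le_ne_top (ENNReal.ofReal_ne_top (r := Real.pi)) ?_
  rw [← hilbertArea_ball hi ha hb hc]
  refine setLIntegral_mono' (isOpen_openTriangle hi).measurableSet fun x hx => ?_
  exact ENNReal.div_le_div_left
    (measure_mono fun v hv => (hilbertNorm_anti Metric.isOpen_ball (hballT hx) hf v).trans_lt hv) _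

/-- The second supporting functional is x ↦ ⟨a, x⟩, from the tangent to the circle at a. It is
strictly smaller at b, so a is a corner ending a flat side. -/
theorem exists_ideal_triangle_of_flat_side {D : Set Plane} (hD : IsConvexDomain D)
    (hDB : D ⊆ Metric.ball 0 1) {a b : Plane} (ha : ‖a‖ = 1) (hb : ‖b‖ = 1) (hab : a ≠ b)
    (haD : a ∈ closure D) (hbD : b ∈ closure D) (h : ¬ openSegment ℝ a b ⊆ D) {K : ENNReal}
    (hK : K ≠ ⊤) :
    ∃ x y z, IsIdealTriangle D x y z ∧ K < hilbertArea volume D (openTriangle x y z) := by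
  obtain ⟨f, hf, hfb⟩ := exists_supporting_functional hD.isOpen hD.convex haD hbD h
  have haa : inner ℝ a a = 1 := by rw [real_inner_self_eq_norm_sq, ha]; norm_num
  refine exists_large_ideal_triangle hD haD hbD hf hfb (g := innerSL ℝ a) (fun x hx => ?_) ?_ hK
  · rw [innerSL_apply_apply, innerSL_apply_apply, haa]
    have h1 : ‖x‖ < 1 := by simpa using hDB hx
    have h2 := real_inner_le_norm a x
    rw [ha, one_mul] at h2
    linarith
  · rw [innerSL_apply_apply, innerSL_apply_apply, haa]
    have h1 : 0 < ‖a - b‖ ^ 2 := by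
      have := norm_pos_iff.2 (sub_ne_zero.2 hab)
      positivity
    rw [norm_sub_sq_real, ha, hb] at h1
    linarith

theorem exists_pi_lt_ideal_triangle {D : Set Plane} (hD : IsConvexDomain D)
    (hE : ¬ IsEllipsoid D) : ∃ a b c, IsIdealTriangle D a b c ∧
      ENNReal.ofReal Real.pi < hilbertArea volume D (openTriangle a b c) := by
  obtain ⟨f, hf, a, b, c, ha, hb, hc, haD, hbD, hcD, hab, hbc, hca⟩ :=
    exists_circumscribed_position hD
  have hD' := isConvexDomain_preimage hD f
  suffices ∃ a b c, IsIdealTriangle (f ⁻¹' D) a b c ∧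
      ENNReal.ofReal Real.pi < hilbertArea volume (f ⁻¹' D) (openTriangle a b c) by
    obtain ⟨x, y, z, hT, hlt⟩ := this
    exact ⟨f x, f y, f z, hT.map (f : Plane →ᵃ[ℝ] Plane) f.injective, by rwa [hilbertArea_map]⟩
  have hcl : ∀ x : Plane, f x ∈ closure D → x ∈ closure (f ⁻¹' D) := fun x hx => by
    have := (AffineEquiv.toContinuousAffineEquiv f).toHomeomorph.preimage_closure D
    exact this ▸ hx
  by_cases h1 : openSegment ℝ a b ⊆ f ⁻¹' D
  swap
  · exact exists_ideal_triangle_of_flat_side hD' hf ha hb hab (hcl a haD) (hcl b hbD) h1 (by simp)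
  by_cases h2 : openSegment ℝ b c ⊆ f ⁻¹' D
  swap
  · exact exists_ideal_triangle_of_flat_side hD' hf hb hc hbc (hcl b hbD) (hcl c hcD) h2 (by simp)
  by_cases h3 : openSegment ℝ c a ⊆ f ⁻¹' D
  swap
  · exact exists_ideal_triangle_of_flat_side hD' hf hc ha hca (hcl c hcD) (hcl a haD) h3 (by simp)
  have hi := affineIndependent_of_norm_eq_one ha hb hc hab hbc hca
  have hn : ∀ x : Plane, ‖x‖ = 1 → x ∉ f ⁻¹' D := fun x hx hxD => by simpa [hx] using hf hxD
  have hT := isIdealTriangle_of_sides hD'.isOpen hD'.convex hi ⟨hcl a haD, hn a ha⟩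
    ⟨hcl b hbD, hn b hb⟩ ⟨hcl c hcD, hn c hc⟩ h1 h2 h3
  refine ⟨a, b, c, hT, ?_⟩
  have hss : f ⁻¹' D ⊂ Metric.ball 0 1 :=
    hf.ssubset_of_ne fun h => hE (isEllipsoid_of_preimage_eq_ball f h)
  rw [← hilbertArea_ball hi ha hb hc]
  refine hilbertArea_lt_of_ssubset hD'.isOpen hD'.convex hD'.isBounded Metric.isOpen_ball
    (convex_ball 0 1) hss (isOpen_openTriangle hi) (openTriangle_nonempty _ _ _)
    hT.triangle_subset ?_
  rw [hilbertArea_ball hi ha hb hc]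
  simp

/-! ### Ellipsoids recognised from their plane sections. -/

/-- A positive definite quadratic form on Euclidean space is the square of the norm, up to a linear
automorphism. -/
theorem exists_linearEquiv_norm_sq (Q : QuadraticForm ℝ (EuclideanSpace ℝ (Fin n)))
    (hQ : Q.PosDef) : ∃ L : EuclideanSpace ℝ (Fin n) ≃ₗ[ℝ] EuclideanSpace ℝ (Fin n),
      ∀ v, Q v = ‖L v‖ ^ 2 := by
  obtain ⟨w, ⟨e⟩⟩ := Q.equivalent_weightedSumSquares
  have hn : n = finrank ℝ (EuclideanSpace ℝ (Fin n)) := by simp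
  have hw : ∀ i, 0 < w i := by
    intro i
    have h1 : QuadraticMap.weightedSumSquares ℝ w (Pi.single i 1) = w i := by
      rw [QuadraticMap.weightedSumSquares_apply, Finset.sum_eq_single i]
      · simp
      · intro j _ hj
        simp [hj]
      · simp
    rw [← h1, ← e.symm.map_app]
    refine hQ _ fun h => ?_
    have h2 : (Pi.single i 1 : Fin (finrank ℝ (EuclideanSpace ℝ (Fin n))) → ℝ) = 0 :=
      e.symm.toLinearEquiv.map_eq_zero_iff.1 h
    simpa using congrFun h2 i
  let L : EuclideanSpace ℝ (Fin n) →ₗ[ℝ] EuclideanSpace ℝ (Fin n) :=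
    (EuclideanSpace.equiv (Fin n) ℝ).symm.toLinearMap ∘ₗ
      LinearMap.pi fun j => √(w (finCongr hn j)) •
        (LinearMap.proj (finCongr hn j) ∘ₗ e.toLinearEquiv.toLinearMap)
  have hL : ∀ v, Q v = ‖L v‖ ^ 2 := by
    intro v
    rw [EuclideanSpace.norm_sq_eq, ← e.map_app, QuadraticMap.weightedSumSquares_apply,
      ← (finCongr hn).sum_comp]
    refine Finset.sum_congr rfl fun j _ => ?_
    have h1 : L v j = √(w (finCongr hn j)) * e v (finCongr hn j) := rfl
    rw [h1, Real.norm_eq_abs, sq_abs, mul_pow, Real.sq_sqrt (hw _).le, smul_eq_mul]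
    ring
  have hinj : Function.Injective L := by
    rw [injective_iff_map_eq_zero]
    intro v hv
    by_contra hne
    have := hQ v hne
    rw [hL, hv] at this
    simp at this
  exact ⟨LinearEquiv.ofInjectiveEndo L hinj, hL⟩

/-- After a linear change of variables L and with d representing l, the inequality reads ‖L (x - p)
+ d‖² < 1 + ‖d‖². -/
theorem isEllipsoid_of_quadratic {C : Set (EuclideanSpace ℝ (Fin n))}
    (p : EuclideanSpace ℝ (Fin n)) (Q : QuadraticForm ℝ (EuclideanSpace ℝ (Fin n)))
    (hQ : Q.PosDef) (l : EuclideanSpace ℝ (Fin n) →ₗ[ℝ] ℝ)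
    (hC : ∀ x, x ∈ C ↔ Q (x - p) + 2 * l (x - p) < 1) : IsEllipsoid C := by
  obtain ⟨L, hL⟩ := exists_linearEquiv_norm_sq Q hQ
  let d := (InnerProductSpace.toDual ℝ (EuclideanSpace ℝ (Fin n))).symm
    (LinearMap.toContinuousLinearMap (l ∘ₗ L.symm.toLinearMap))
  have hd : ∀ v, l v = inner ℝ d (L v) := by
    intro v
    rw [InnerProductSpace.toDual_symm_apply]
    simp
  set ρ := √(1 + ‖d‖ ^ 2) with hρ
  have hρ0 : 0 < ρ := Real.sqrt_pos.2 (by positivity)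
  have hρ2 : ρ ^ 2 = 1 + ‖d‖ ^ 2 := Real.sq_sqrt (by positivity)
  let f : EuclideanSpace ℝ (Fin n) ≃ᵃ[ℝ] EuclideanSpace ℝ (Fin n) :=
    (((AffineEquiv.constVAdd ℝ (EuclideanSpace ℝ (Fin n)) (-p)).trans L.toAffineEquiv).trans
      (AffineEquiv.constVAdd ℝ (EuclideanSpace ℝ (Fin n)) d)).trans
      (LinearEquiv.smulOfNeZero ℝ (EuclideanSpace ℝ (Fin n)) ρ⁻¹
        (inv_ne_zero hρ0.ne')).toAffineEquiv
  have hf : ∀ x, f x = ρ⁻¹ • (d + L (x - p)) := by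
    intro x
    change ρ⁻¹ • (d + L (-p + x)) = _
    rw [neg_add_eq_sub]
  refine isEllipsoid_of_preimage_eq_ball f.symm ?_
  ext y
  have hy : f (f.symm y) = y := f.apply_symm_apply y
  rw [mem_preimage, hC, mem_ball_zero_iff, ← sq_lt_one_iff₀ (norm_nonneg y)]
  conv_rhs => rw [← hy]
  rw [hf, norm_smul, mul_pow, norm_add_sq_real, ← hL, ← hd, norm_inv, Real.norm_of_nonneg hρ0.le,
    inv_pow, inv_mul_lt_iff₀ (by positivity), hρ2]
  constructor <;> intro h <;> linarith

section Sections

variable {C : Set (EuclideanSpace ℝ (Fin n))} {p : EuclideanSpace ℝ (Fin n)}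

/-- The odd part of the exit rate. -/
def oddRate (C : Set (EuclideanSpace ℝ (Fin n))) (p v : EuclideanSpace ℝ (Fin n)) : ℝ :=
  (exitRate C p v - exitRate C p (-v)) / 2

theorem oddRate_neg (v : EuclideanSpace ℝ (Fin n)) : oddRate C p (-v) = -oddRate C p v := by
  rw [oddRate, oddRate, neg_neg]; ring

theorem oddRate_smul (r : ℝ) (v : EuclideanSpace ℝ (Fin n)) :
    oddRate C p (r • v) = r * oddRate C p v := by
  have h : ∀ r : ℝ, 0 ≤ r → ∀ v, oddRate C p (r • v) = r * oddRate C p v := by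
    intro r hr v
    rw [oddRate, oddRate, ← smul_neg, exitRate_smul _ _ _ hr, exitRate_smul _ _ _ hr]
    ring
  rcases le_total 0 r with hr | hr
  · exact h r hr v
  · rw [← neg_neg (r • v), oddRate_neg, ← neg_smul, h _ (neg_nonneg.2 hr)]
    ring

theorem sq_hilbertNorm_smul (r : ℝ) (v : EuclideanSpace ℝ (Fin n)) :
    hilbertNorm C p (r • v) ^ 2 = r ^ 2 * hilbertNorm C p v ^ 2 := by
  rcases le_total 0 r with hr | hr
  · rw [hilbertNorm_smul _ _ _ hr, mul_pow]
  · rw [← neg_neg (r • v), hilbertNorm_neg, ← neg_smul, hilbertNorm_smul _ _ _ (neg_nonneg.2 hr)]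
    ring

/-- If the plane sections through `p` are ellipses, then along any pair of vectors the square of the
Hilbert norm is quadratic and the odd part of the exit rate is linear. -/
theorem exists_quadratic_on_pair (hp : p ∈ C)
    (h : ∀ ι : Plane →ᵃⁱ[ℝ] EuclideanSpace ℝ (Fin n), (ι ⁻¹' C).Nonempty → IsEllipsoid (ι ⁻¹' C))
    (u v : EuclideanSpace ℝ (Fin n)) :
    ∃ α β γ δ ε : ℝ, ∀ s t : ℝ,
      hilbertNorm C p (s • u + t • v) ^ 2 = α * s ^ 2 + β * (s * t) + γ * t ^ 2 ∧
      oddRate C p (s • u + t • v) = δ * s + ε * t := by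
  by_cases hi : AffineIndependent ℝ ![p, p + u, p + v]
  · obtain ⟨ι, a, b, c, -, ha, hb, hc⟩ := exists_affineIsometry hi
    obtain ⟨A, hA⟩ := h ι ⟨a, by rwa [mem_preimage, ha]⟩
    have hA' : ι ⁻¹' C = (A.symm : Plane →ᵃ[ℝ] Plane) ⁻¹' Metric.ball 0 1 := by
      rw [hA]
      ext x
      constructor
      · rintro ⟨y, hy, rfl⟩
        simpa using hy
      · intro hx
        exact ⟨A.symm x, hx, by simp⟩
    set y := A.symm a with hy
    have hy1 : ‖y‖ < 1 := by
      have : a ∈ ι ⁻¹' C := by rwa [mem_preimage, ha]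
      rw [hA'] at this
      exact mem_ball_zero_iff.1 this
    have hu : ι.linear (b - a) = u := by
      have : ι.linear (b - a) = ι b - ι a := ι.toAffineMap.linearMap_vsub b a
      rw [this, ha, hb, add_sub_cancel_left]
    have hv : ι.linear (c - a) = v := by
      have : ι.linear (c - a) = ι c - ι a := ι.toAffineMap.linearMap_vsub c a
      rw [this, ha, hc, add_sub_cancel_left]
    set w₁ := A.symm.linear (b - a)
    set w₂ := A.symm.linear (c - a)
    have hrate : ∀ s t : ℝ, exitRate C p (s • u + t • v) =
        exitRate (Metric.ball 0 1) y (s • w₁ + t • w₂) := by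
      intro s t
      have h1 := exitRate_preimage ι.toAffineMap C a (s • (b - a) + t • (c - a))
      have h2 := exitRate_preimage (A.symm : Plane →ᵃ[ℝ] Plane) (Metric.ball 0 1) a
        (s • (b - a) + t • (c - a))
      rw [← hA'] at h2
      rw [map_add, map_smul, map_smul] at h1 h2
      rw [← hu, ← hv, ← ha]
      exact h1.symm.trans h2
    have hneg : ∀ s t : ℝ, exitRate C p (-(s • u + t • v)) =
        exitRate (Metric.ball 0 1) y (-(s • w₁ + t • w₂)) := by
      intro s t
      have := hrate (-s) (-t)
      simpa only [neg_smul, ← neg_add] using this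
    set G := 1 - ‖y‖ ^ 2 with hG
    have hG0 : 0 < G := by have := norm_nonneg y; nlinarith
    refine ⟨((inner ℝ y w₁) ^ 2 + G * ‖w₁‖ ^ 2) / G ^ 2,
      (2 * inner ℝ y w₁ * inner ℝ y w₂ + G * (2 * inner ℝ w₁ w₂)) / G ^ 2,
      ((inner ℝ y w₂) ^ 2 + G * ‖w₂‖ ^ 2) / G ^ 2, inner ℝ y w₁ / G, inner ℝ y w₂ / G,
      fun s t => ⟨?_, ?_⟩⟩
    · have h1 : hilbertNorm C p (s • u + t • v) =
          hilbertNorm (Metric.ball 0 1) y (s • w₁ + t • w₂) := by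
        rw [hilbertNorm, hrate, hneg, hilbertNorm]
      rw [h1, hilbertNorm_ball hy1, ← hG, div_pow, Real.sq_sqrt (by positivity), inner_add_right,
        inner_smul_right, inner_smul_right, norm_add_sq_real, norm_smul, norm_smul, mul_pow,
        mul_pow, real_inner_smul_left, inner_smul_right, Real.norm_eq_abs, Real.norm_eq_abs,
        sq_abs, sq_abs]
      field_simp
      ring
    · rw [oddRate, hrate, hneg, exitRate_sub_ball hy1, ← hG, inner_add_right, inner_smul_right,
        inner_smul_right]
      field_simp
  -- Dependent vectors lie on one line, where homogeneity suffices. When n < 2 this is the only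
  -- case, so every domain is then an ellipsoid.
  · have : ∃ (e : EuclideanSpace ℝ (Fin n)) (x y : ℝ), u = x • e ∧ v = y • e := by
      rw [linearIndependent_of_triple, add_sub_cancel_left, add_sub_cancel_left,
        LinearIndependent.pair_iff] at hi
      push Not at hi
      obtain ⟨s, t, hst, hne⟩ := hi
      by_cases hs : s = 0
      · have ht := hne hs
        rw [hs, zero_smul, zero_add] at hst
        have : v = 0 := (smul_eq_zero.1 hst).resolve_left ht
        exact ⟨u, 1, 0, by simp, by simp [this]⟩
      · refine ⟨v, -(t / s), 1, ?_, by simp⟩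
        have : s • u = -(t • v) := eq_neg_of_add_eq_zero_left hst
        rw [← inv_smul_smul₀ hs u, this, smul_neg, smul_smul, neg_smul, div_eq_inv_mul]
    obtain ⟨e, x, y, rfl, rfl⟩ := this
    refine ⟨x ^ 2 * hilbertNorm C p e ^ 2, 2 * (x * y) * hilbertNorm C p e ^ 2,
      y ^ 2 * hilbertNorm C p e ^ 2, x * oddRate C p e, y * oddRate C p e, fun s t => ?_⟩
    have h1 : s • x • e + t • y • e = (s * x + t * y) • e := by module
    rw [h1, sq_hilbertNorm_smul, oddRate_smul]
    constructor <;> ring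

/-- A convex domain whose plane sections are ellipses is an ellipsoid. -/
theorem isEllipsoid_of_sections (hC : IsConvexDomain C)
    (h : ∀ ι : Plane →ᵃⁱ[ℝ] EuclideanSpace ℝ (Fin n), (ι ⁻¹' C).Nonempty →
      IsEllipsoid (ι ⁻¹' C)) : IsEllipsoid C := by
  obtain ⟨p, hp⟩ := hC.nonempty
  have hpair := exists_quadratic_on_pair hp h
  let l : EuclideanSpace ℝ (Fin n) →ₗ[ℝ] ℝ :=
    { toFun := oddRate C p
      map_add' := fun u v => by
        obtain ⟨α, β, γ, δ, ε, H⟩ := hpair u v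
        have h1 := (H 1 1).2
        have h2 := (H 1 0).2
        have h3 := (H 0 1).2
        simp only [one_smul, zero_smul, add_zero, zero_add] at h1 h2 h3
        rw [h1, h2, h3]; ring
      map_smul' := fun r v => oddRate_smul r v }
  set N : EuclideanSpace ℝ (Fin n) → ℝ := fun v => hilbertNorm C p v ^ 2 with hN
  have par : ∀ u v, N (u + v) + N (u - v) = 2 * N u + 2 * N v := by
    intro u v
    obtain ⟨α, β, γ, δ, ε, H⟩ := hpair u v
    have h1 := (H 1 1).1
    have h2 := (H 1 (-1)).1
    have h3 := (H 1 0).1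
    have h4 := (H 0 1).1
    simp only [one_smul, zero_smul, add_zero, zero_add, neg_smul, ← sub_eq_add_neg] at h1 h2 h3 h4
    simp only [hN, h1, h2, h3, h4]
    ring
  let NQ : QuadraticForm ℝ (EuclideanSpace ℝ (Fin n)) := QuadraticMap.ofPolar N
    (fun r v => by rw [hN, smul_eq_mul]; simp only [sq_hilbertNorm_smul]; ring)
    -- Additivity of the polar form follows from four instances of the parallelogram law, as in the
    -- Jordan–von Neumann theorem.
    (fun x y z => by
      have h1 := par (x + z) y
      have h2 := par x (z - y)
      have h3 := par (x + y) z
      have h4 := par z y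
      have e1 : x + z + y = x + y + z := by abel
      have e2 : x + (z - y) = x + z - y := by abel
      have e3 : x - (z - y) = x + y - z := by abel
      have e4 : z + y = y + z := by abel
      rw [e1] at h1
      rw [e2, e3] at h2
      rw [e4] at h4
      simp only [QuadraticMap.polar]
      linarith)
    (fun r x y => by
      obtain ⟨α, β, γ, δ, ε, H⟩ := hpair x y
      have h1 := (H 1 1).1
      have h2 := (H r 1).1
      have h3 := (H 1 0).1
      have h4 := (H 0 1).1
      have h5 := (H r 0).1
      simp only [one_smul, zero_smul, add_zero, zero_add] at h1 h2 h3 h4 h5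
      simp only [QuadraticMap.polar, hN, h1, h2, h3, h4, h5, smul_eq_mul]
      ring)
  -- With r and r' the exit rates of v and -v, Q v = r r' and 2 l v = r - r'. Hence Q + 2 l - 1 = (r
  -- - 1)(1 + r'), which is negative exactly when r < 1, that is, when p + v lies in C.
  let Q : QuadraticForm ℝ (EuclideanSpace ℝ (Fin n)) := NQ - QuadraticMap.sq.comp l
  have hQ : ∀ v, Q v = hilbertNorm C p v ^ 2 - oddRate C p v ^ 2 := by
    intro v
    change hilbertNorm C p v ^ 2 - oddRate C p v * oddRate C p v = _
    ring
  have hQ' : ∀ v, Q v = exitRate C p v * exitRate C p (-v) := by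
    intro v
    rw [hQ, hilbertNorm, oddRate]; ring
  refine isEllipsoid_of_quadratic p Q (fun v hv => ?_) l fun x => ?_
  · rw [hQ']
    exact mul_pos (exitRate_pos hC.isOpen hC.isBounded hp hv)
      (exitRate_pos hC.isOpen hC.isBounded hp (neg_ne_zero.2 hv))
  · have h1 := exitRate_lt_one_iff hC.isOpen hC.convex hp (x - p)
    rw [add_sub_cancel] at h1
    have h2 := exitRate_nonneg C p (-(x - p))
    have h3 : l (x - p) = (exitRate C p (x - p) - exitRate C p (-(x - p))) / 2 := rfl
    have h4 : Q (x - p) + 2 * l (x - p) - 1 =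
        (exitRate C p (x - p) - 1) * (1 + exitRate C p (-(x - p))) := by
      rw [hQ', h3]; ring
    rw [← h1, ← sub_neg, ← sub_neg (a := Q (x - p) + 2 * l (x - p)), h4]
    refine ⟨fun h => mul_neg_of_neg_of_pos h (by linarith), fun h => ?_⟩
    by_contra hcon
    exact absurd h (not_lt.2 (mul_nonneg (not_lt.1 hcon) (by linarith)))

end Sections

theorem exists_section {C : Set (EuclideanSpace ℝ (Fin n))} (hC : IsConvexDomain C)
    (hE : ¬ IsEllipsoid C) : ∃ ι : Plane →ᵃⁱ[ℝ] EuclideanSpace ℝ (Fin n),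
      IsConvexDomain (ι ⁻¹' C) ∧ ¬ IsEllipsoid (ι ⁻¹' C) := by
  by_contra! hcon
  exact hE (isEllipsoid_of_sections hC fun ι hι => hcon ι
    ⟨hι, hC.isOpen.preimage ι.continuous, hC.convex.affine_preimage ι.toAffineMap,
      ι.isometry.antilipschitz.isBounded_preimage hC.isBounded⟩)

end HilbertGeometry

end

theorem mainTheorem1 (n : ℕ) (C : Set (EuclideanSpace ℝ (Fin n)))
    (hC : HilbertGeometry.IsConvexDomain C) :
    ((∃ A : ENNReal, ∀ a b c : EuclideanSpace ℝ (Fin n),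
        HilbertGeometry.IsIdealTriangle C a b c → HilbertGeometry.triangleArea C a b c = A) ↔
      HilbertGeometry.IsEllipsoid C) ∧
    (HilbertGeometry.IsEllipsoid C → ∀ a b c : EuclideanSpace ℝ (Fin n),
      HilbertGeometry.IsIdealTriangle C a b c →
        HilbertGeometry.triangleArea C a b c = ENNReal.ofReal Real.pi) ∧
    (¬ HilbertGeometry.IsEllipsoid C →
      (∃ a b c : EuclideanSpace ℝ (Fin n), HilbertGeometry.IsIdealTriangle C a b c ∧
        ENNReal.ofReal Real.pi < HilbertGeometry.triangleArea C a b c) ∧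
      (∃ a b c : EuclideanSpace ℝ (Fin n), HilbertGeometry.IsIdealTriangle C a b c ∧
        HilbertGeometry.triangleArea C a b c < ENNReal.ofReal Real.pi)) := by
  have ellipsoid : HilbertGeometry.IsEllipsoid C → ∀ a b c : EuclideanSpace ℝ (Fin n),
      HilbertGeometry.IsIdealTriangle C a b c →
        HilbertGeometry.triangleArea C a b c = ENNReal.ofReal Real.pi :=
    fun hE a b c h => HilbertGeometry.triangleArea_of_isEllipsoid hC hE h
  have nonellipsoid : ¬ HilbertGeometry.IsEllipsoid C →
      (∃ a b c : EuclideanSpace ℝ (Fin n), HilbertGeometry.IsIdealTriangle C a b c ∧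
        ENNReal.ofReal Real.pi < HilbertGeometry.triangleArea C a b c) ∧
      (∃ a b c : EuclideanSpace ℝ (Fin n), HilbertGeometry.IsIdealTriangle C a b c ∧
        HilbertGeometry.triangleArea C a b c < ENNReal.ofReal Real.pi) := by
    intro hE
    obtain ⟨ι, hD, hDE⟩ := HilbertGeometry.exists_section hC hE
    obtain ⟨a, b, c, h, hlt⟩ := HilbertGeometry.exists_pi_lt_ideal_triangle hD hDE
    obtain ⟨a', b', c', h', hlt'⟩ := HilbertGeometry.exists_ideal_triangle_lt_pi hD hDE
    have hι := h.map ι.toAffineMap ι.injective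
    have hι' := h'.map ι.toAffineMap ι.injective
    have e := HilbertGeometry.triangleArea_eq_hilbertArea hC ι h.affineIndependent
      hι.triangle_subset
    have e' := HilbertGeometry.triangleArea_eq_hilbertArea hC ι h'.affineIndependent
      hι'.triangle_subset
    exact ⟨⟨_, _, _, hι, hlt.trans_eq e.symm⟩, ⟨_, _, _, hι', e'.trans_lt hlt'⟩⟩
  refine ⟨⟨?_, fun hE => ⟨_, ellipsoid hE⟩⟩, ellipsoid, nonellipsoid⟩
  rintro ⟨A, hA⟩
  by_contra hE
  obtain ⟨⟨a, b, c, h, hlt⟩, a', b', c', h', hlt'⟩ := nonellipsoid hE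
  rw [hA a b c h] at hlt
  rw [hA a' b' c' h'] at hlt'
  exact lt_asymm hlt hlt'
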